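/- **Theorem 4.3.** Consider a two-player zero-sum quantum game: Alice sends a density matrix $\rho$ on $\mathcal A=\mathbb C^n$ and Bob a density matrix $\sigma$ on $\mathcal B=\mathbb C^m$ to a referee, who performs a joint measurement $\{R_a\}_{a=1}^k$ ($R_a\succeq 0$, $\sum_a R_a=\mathbb 1_{\mathcal A\otimes\mathcal B}$); on outcome $a$ Alice receives $v(a)\in\mathbb R$ and Bob receives $-v(a)$. Put $R=\sum_a v(a)R_a$, let $u(\rho,\sigma)=\mathrm{Tr}(R(\rho\otimes\sigma))$ be Alice's expected payoff, let $\Phi(\sigma)=\mathrm{Tr}_{\mathcal B}\big(R(\mathbb 1_{\mathcal A}\otimes\sigma)\big)$ be the super-operator with $u(\rho,\sigma)=\mathrm{Tr}(\rho\,\Phi(\sigma))$, and let $\Phi^\dagger$ be its adjoint for the inner product $\langle X,Y\rangle=\mathrm{Tr}(X^\dagger Y)$. A Nash equilibrium is a pair of density matrices $(\rho^*,\sigma^*)$ such that $u(\rho,\sigma^*)\le u(\rho^*,\sigma^*)\le u(\rho^*,\sigma)$ for all density matrices $\rho,\sigma$; it is fully mixed if $\rho^*$ and $\sigma^*$ have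 full rank. An orbit of the quantum replicator dynamics is a curve $t\mapsto(\rho(t),\sigma(t))$, $t\in\mathbb R$, of the form $$\rho(t)=\frac{e^{A(t)}}{\mathrm{Tr}\,e^{A(t)}},\qquad \sigma(t)=\frac{e^{B(t)}}{\mathrm{Tr}\,e^{B(t)}},\qquad \frac{dA}{dt}=\Phi(\sigma(t)),\qquad \frac{dB}{dt}=-\Phi^\dagger(\rho(t)),$$ with $A(t)$, $B(t)$ Hermitian. Suppose that the game has a fully mixed Nash equilibrium. Then the quantum replicator dynamics are Poincaré recurrent. That is: through every pair $(\rho_0,\sigma_0)$ of full-rank density matrices there passes exactly one orbit with $(\rho(0),\sigma(0))=(\rho_0,\sigma_0)$; and for almost every such pair, with respect to Lebesgue measure on the real affine space of pairs of trace-one Hermitian matrices, the orbit returns arbitrarily close to its initial condition infinitely often: there is a sequence of times $t_k\to+\infty$ with $(\rho(t_k),\sigma(t_k))\to(\rho_0,\sigma_0)$. -/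

import Mathlib

open MeasureTheory Filter Topology
open scoped Matrix Kronecker ComplexOrder

noncomputable section

namespace QuantumGame

/-- Complex square matrices of size `n`, that is, the operators on `ℂⁿ`. -/
abbrev Mat (n : ℕ) := Matrix (Fin n) (Fin n) ℂ

/-- Operators on the joint register `ℂⁿ ⊗ ℂᵐ`. -/
abbrev JointMat (n m : ℕ) := Matrix (Fin n × Fin m) (Fin n × Fin m) ℂ

/-- Hilbert-Schmidt inner product `⟨A, B⟩ = Tr (A† B)`. -/
def hsInner {ι : Type*} [Fintype ι] (A B : Matrix ι ι ℂ) : ℂ := (Aᴴ * B).trace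

/-- Density matrices: positive semidefinite of trace one. -/
def IsDensityMatrix {n : ℕ} (ρ : Mat n) : Prop := ρ.PosSemidef ∧ ρ.trace = 1

/-- Density matrices of full rank. -/
def IsFullRankState {n : ℕ} (ρ : Mat n) : Prop := IsDensityMatrix ρ ∧ ρ.rank = n

/-- Partial trace over the second register. -/
def partialTraceB {n m : ℕ} (M : JointMat n m) : Mat n :=
  Matrix.of fun i i' => ∑ j, M (i, j) (i', j)

/-- Partial trace over the first register. -/
def partialTraceA {n m : ℕ} (M : JointMat n m) : Mat m :=
  Matrix.of fun j j' => ∑ i, M (i, j) (i, j')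

theorem trace_mul_partialTraceB {n m : ℕ} (A : Mat n) (M : JointMat n m) :
    (A * partialTraceB M).trace = ((A ⊗ₖ (1 : Mat m)) * M).trace := by
  simp only [partialTraceB, Matrix.trace, Matrix.diag, Matrix.mul_apply, Matrix.of_apply,
    Matrix.kroneckerMap_apply, Fintype.sum_prod_type, Matrix.one_apply, Finset.mul_sum, ite_mul,
    mul_ite, mul_one, zero_mul, mul_zero, Finset.sum_ite_eq, Finset.mem_univ, if_true]
  exact Finset.sum_congr rfl fun i _ => Finset.sum_comm

theorem trace_partialTraceA_mul {n m : ℕ} (M : JointMat n m) (B : Mat m) :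
    (partialTraceA M * B).trace = (M * ((1 : Mat n) ⊗ₖ B)).trace := by
  simp only [partialTraceA, Matrix.trace, Matrix.diag, Matrix.mul_apply, Matrix.of_apply,
    Matrix.kroneckerMap_apply, Fintype.sum_prod_type, Matrix.one_apply, Finset.sum_mul, ite_mul,
    mul_ite, one_mul, zero_mul, mul_zero]
  simp only [Finset.sum_comm (s := Finset.univ (α := Fin n)) (t := Finset.univ (α := Fin m)),
    Finset.sum_ite_eq', Finset.mem_univ, if_true]

theorem partialTraceA_conjTranspose {n m : ℕ} (M : JointMat n m) :
    (partialTraceA M)ᴴ = partialTraceA Mᴴ := by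
  ext j j'
  simp [partialTraceA, Matrix.conjTranspose_apply]

/-- A two-player zero-sum quantum game: Alice sends a state on `ℂⁿ`, Bob a state on `ℂᵐ`, the
referee performs a joint measurement with finitely many outcomes, and on outcome `a` Alice receives
the real payoff `value a` and Bob receives `-value a`. -/
structure ZeroSumGame (n m : ℕ) where
  outcomes : ℕ
  measurement : Fin outcomes → JointMat n m
  measurement_posSemidef : ∀ a, (measurement a).PosSemidef
  sum_measurement : ∑ a, measurement a = 1
  value : Fin outcomes → ℝ

namespace ZeroSumGame

variable {n m : ℕ} (G : ZeroSumGame n m)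

/-- Alice's expected payoff `u(ρ, σ) = ∑ₐ v(a) ⟨Rₐ, ρ ⊗ σ⟩`; Bob's is `-u(ρ, σ)`. -/
def payoff (ρ : Mat n) (σ : Mat m) : ℝ :=
  ∑ a, G.value a * (hsInner (G.measurement a) (ρ ⊗ₖ σ)).re

/-- The payoff observable `R = ∑ₐ v(a) Rₐ`. -/
def payoffObservable : JointMat n m := ∑ a, (G.value a : ℂ) • G.measurement a

/-- Nash equilibrium in density matrices: Alice cannot increase `u` and Bob cannot decrease it. -/
def IsNash (ρs : Mat n) (σs : Mat m) : Prop :=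
  IsDensityMatrix ρs ∧ IsDensityMatrix σs ∧
    (∀ ρ, IsDensityMatrix ρ → G.payoff ρ σs ≤ G.payoff ρs σs) ∧
    (∀ σ, IsDensityMatrix σ → G.payoff ρs σs ≤ G.payoff ρs σ)

/-- The game has a fully mixed (full-rank) Nash equilibrium. -/
def HasFullyMixedNash : Prop :=
  ∃ (ρs : Mat n) (σs : Mat m), G.IsNash ρs σs ∧ ρs.rank = n ∧ σs.rank = m

/-- The payoff super-operator `Φ(σ) = Tr_B (R (1 ⊗ σ))`, which satisfies
`u(ρ, σ) = ⟨ρ, Φ(σ)⟩`, see `payoff_eq`. -/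
def superOp (σ : Mat m) : Mat n :=
  partialTraceB (G.payoffObservable * ((1 : Mat n) ⊗ₖ σ))

/-- The adjoint super-operator `Φ†(ρ) = Tr_A (R† (ρ ⊗ 1))`, see `hsInner_superOp`. -/
def superOpAdj (ρ : Mat n) : Mat m :=
  partialTraceA (G.payoffObservableᴴ * (ρ ⊗ₖ (1 : Mat m)))

/-- `Φ†` is the adjoint of `Φ`: `⟨A, Φ(B)⟩ = ⟨Φ†(A), B⟩`. -/
theorem hsInner_superOp (A : Mat n) (B : Mat m) :
    hsInner A (G.superOp B) = hsInner (G.superOpAdj A) B := by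
  rw [hsInner, hsInner, superOp, superOpAdj, trace_mul_partialTraceB, partialTraceA_conjTranspose,
    trace_partialTraceA_mul, Matrix.conjTranspose_mul, Matrix.conjTranspose_conjTranspose,
    Matrix.conjTranspose_kronecker, Matrix.conjTranspose_one, Matrix.mul_assoc]

/-- `u(ρ, σ) = ⟨ρ, Φ(σ)⟩` for Hermitian `ρ`. -/
theorem payoff_eq (ρ : Mat n) (σ : Mat m) (hρ : ρ.IsHermitian) :
    G.payoff ρ σ = (hsInner ρ (G.superOp σ)).re := by
  have h : hsInner ρ (G.superOp σ) = (G.payoffObservable * (ρ ⊗ₖ σ)).trace := by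
    rw [hsInner, superOp, trace_mul_partialTraceB, hρ.eq, Matrix.trace_mul_comm, Matrix.mul_assoc,
      ← Matrix.mul_kronecker_mul, Matrix.one_mul, Matrix.mul_one]
  rw [h, payoffObservable, Finset.sum_mul, Matrix.trace_sum, Complex.re_sum, payoff]
  refine Finset.sum_congr rfl fun a _ => ?_
  rw [hsInner, (G.measurement_posSemidef a).isHermitian.eq, Matrix.smul_mul, Matrix.trace_smul,
    smul_eq_mul, Complex.re_ofReal_mul]

end ZeroSumGame

/-- The normalized exponential `exp(A) / Tr(exp(A))`. -/
def gibbs {n : ℕ} (A : Mat n) : Mat n := (NormedSpace.exp A).trace⁻¹ • NormedSpace.exp A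

/-- `(ρ, σ)` is an orbit of the quantum replicator dynamics, for all real times:
`ρ = exp(A) / Tr(exp(A))` and `σ = exp(B) / Tr(exp(B))`, where `A`, `B` are Hermitian and
`A(t) = A(0) + ∫₀ᵗ Φ(σ)`, `B(t) = B(0) - ∫₀ᵗ Φ†(ρ)`, written in the differentiated form
`dA/dt = Φ(σ)`, `dB/dt = -Φ†(ρ)`. -/
def IsReplicatorOrbit {n m : ℕ} (G : ZeroSumGame n m) (x : ℝ → Mat n × Mat m) : Prop :=
  ∃ (A : ℝ → Mat n) (B : ℝ → Mat m), ∀ t : ℝ,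
    (A t).IsHermitian ∧ (B t).IsHermitian ∧
    x t = (gibbs (A t), gibbs (B t)) ∧
    HasDerivAt A (G.superOp (x t).2) t ∧
    HasDerivAt B (-G.superOpAdj (x t).1) t

/-- The real vector space of traceless Hermitian matrices. -/
def tracelessHermitian (n : ℕ) : Submodule ℝ (Mat n) where
  carrier := {X | X.IsHermitian ∧ X.trace = 0}
  add_mem' := fun {X Y} hX hY => ⟨hX.1.add hY.1, by rw [Matrix.trace_add, hX.2, hY.2, add_zero]⟩
  zero_mem' := ⟨Matrix.isHermitian_zero, Matrix.trace_zero _ _⟩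
  smul_mem' := fun c X hX => ⟨by
    have h := hX.1
    rw [Matrix.IsHermitian] at h ⊢
    rw [Matrix.conjTranspose_smul, h, star_trivial], by
    rw [Matrix.trace_smul, hX.2, smul_zero]⟩

/-- The pair of trace-one Hermitian matrices `(1/n + X, 1/m + Y)`. -/
def statePair {n m : ℕ} (p : tracelessHermitian n × tracelessHermitian m) : Mat n × Mat m :=
  ((n : ℂ)⁻¹ • (1 : Mat n) + (p.1 : Mat n), (m : ℂ)⁻¹ • (1 : Mat m) + (p.2 : Mat m))

/-- `P` holds for almost every pair of full-rank states. The pairs of full-rank states form an open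
subset of the affine space of pairs of trace-one Hermitian matrices, and "almost every" refers to
Lebesgue measure on that affine space, in any linear coordinates `b`. -/
def ForAlmostEveryState (n m : ℕ) (P : Mat n × Mat m → Prop) : Prop :=
  ∀ (d : ℕ) (b : Module.Basis (Fin d) ℝ (tracelessHermitian n × tracelessHermitian m)),
    ∀ᵐ c ∂(volume : Measure (Fin d → ℝ)),
      IsFullRankState (statePair (b.equivFun.symm c)).1 →
      IsFullRankState (statePair (b.equivFun.symm c)).2 →
      P (statePair (b.equivFun.symm c))

/-- The orbit returns arbitrarily close to its initial condition at arbitrarily late times. -/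
def IsRecurrentOrbit {X : Type*} [TopologicalSpace X] (x : ℝ → X) : Prop :=
  ∃ τ : ℕ → ℝ, Tendsto τ atTop atTop ∧ Tendsto (fun k => x (τ k)) atTop (𝓝 (x 0))

end QuantumGame

end

/-! Adding a multiple of the identity to `A` or `B` does not change the Gibbs states, so the
dynamics descends to the traceless parts `(a, b)`. There it reads `a' = f(b)`, `b' = g(a)`, where
`f` and `g` are C¹, and bounded because density matrices are. Solutions therefore exist for all
times and are unique, and so are the orbits, since traceless Hermitian matrices are determined by
their Gibbs states (`existsUnique_replicatorOrbit`).

Neither velocity component depends on its own variable, so the field is divergence free and the flow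
preserves Lebesgue measure. In `measurePreserving_time_one` this comes from discretization: a
symplectic Euler step is a composition of two shears, hence preserves volume, and its iterates
converge to the time-one map.

Let `(ρs, σs)` be the fully mixed equilibrium and put `H(a, b) = log Tr e^a - Tr(ρs a) + log Tr e^b
- Tr(σs b)`, a sum of relative entropies up to a constant. At the states `(ρ, σ)` its derivative
along a solution is `u(ρ, σs) - u(ρs, σ)`. A linear functional extremal over the density matrices at
a full-rank one is constant on them, so both terms equal the value of the game and `H` is conserved
(`lyapunov_conserved`). Full rank also gives `ρs ≥ ε` and `σs ≥ δ`, which makes `H` coercive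
(`isBounded_lyapunov_le`). Its sublevel sets are thus invariant and of finite measure, and Poincaré
recurrence applies to the time-one map on each of them (`ae_recurrent_crossField`).

Finally, the passage from log-coordinates to states is C¹ between spaces of equal dimension, so it
carries null sets to null sets (`forAlmostEveryState_of_ae_gibbsPair`). -/

noncomputable section

namespace QuantumGame

/-! ### Global solutions of bounded, locally Lipschitz vector fields, and convergence of one-step
methods. -/

section BoundedFields

open Metric Set
open scoped NNReal

variable {E : Type*} [NormedAddCommGroup E] [NormedSpace ℝ E]

/-- `z` is a solution of `z' = X(z)` for all real times. -/
def IsSolution (X : E → E) (z : ℝ → E) : Prop := ∀ t, HasDerivAt z (X (z t)) t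

variable {X : E → E} {M : ℝ}

theorem norm_sub_le_of_bounded_field {s : Set ℝ} (hs : Convex ℝ s) (hM : ∀ z, ‖X z‖ ≤ M)
    {z : ℝ → E} (hz : ∀ t ∈ s, HasDerivAt z (X (z t)) t) {a b : ℝ} (ha : a ∈ s) (hb : b ∈ s) :
    ‖z b - z a‖ ≤ M * |b - a| :=
  hs.norm_image_sub_le_of_norm_hasDerivWithin_le
    (fun t ht => (hz t ht).hasDerivWithinAt) (fun t _ => hM (z t)) ha hb

/-- A speed at most `M` confines both curves to the ball of radius `‖z 0‖ + M * T`, on which one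
Lipschitz constant is available. -/
theorem eqOn_of_solutions (hL : ∀ R, ∃ K : ℝ≥0, LipschitzOnWith K X (closedBall 0 R))
    (hM : ∀ z, ‖X z‖ ≤ M) {T : ℝ} (hT : 0 < T) {z w : ℝ → E}
    (hz : ∀ t ∈ Ioo (-T) T, HasDerivAt z (X (z t)) t)
    (hw : ∀ t ∈ Ioo (-T) T, HasDerivAt w (X (w t)) t) (h0 : z 0 = w 0) :
    EqOn z w (Ioo (-T) T) := by
  have hM0 : 0 ≤ M := (norm_nonneg _).trans (hM 0)
  have h0T : (0 : ℝ) ∈ Ioo (-T) T := ⟨by linarith, hT⟩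
  obtain ⟨K, hK⟩ := hL (‖z 0‖ + M * T)
  have key : ∀ u : ℝ → E, u 0 = z 0 → (∀ t ∈ Ioo (-T) T, HasDerivAt u (X (u t)) t) →
      ∀ t ∈ Ioo (-T) T, u t ∈ closedBall (0 : E) (‖z 0‖ + M * T) := by
    intro u hu0 hu t ht
    have h1 := norm_sub_le_of_bounded_field (convex_Ioo _ _) hM hu h0T ht
    rw [hu0, sub_zero] at h1
    have h2 : |t| ≤ T := (abs_lt.2 ht).le
    have h3 : M * |t| ≤ M * T := mul_le_mul_of_nonneg_left h2 hM0
    have h4 : ‖u t‖ ≤ ‖u t - z 0‖ + ‖z 0‖ := by simpa using norm_add_le (u t - z 0) (z 0)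
    rw [mem_closedBall_zero_iff]
    linarith
  exact ODE_solution_unique_of_mem_Ioo (v := fun _ => X) (s := fun _ => closedBall 0 _)
    (fun _ _ => hK) h0T (fun t ht => ⟨hz t ht, key z rfl hz t ht⟩)
    (fun t ht => ⟨hw t ht, key w h0.symm hw t ht⟩) h0

theorem IsSolution.unique (hL : ∀ R, ∃ K : ℝ≥0, LipschitzOnWith K X (closedBall 0 R))
    (hM : ∀ z, ‖X z‖ ≤ M) {z w : ℝ → E} (hz : IsSolution X z) (hw : IsSolution X w)
    (h0 : z 0 = w 0) : z = w := by
  funext t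
  refine eqOn_of_solutions hL hM (T := |t| + 1) (by positivity) (fun s _ => hz s) (fun s _ => hw s)
    h0 ?_
  exact abs_lt.1 (lt_add_one |t|)

theorem IsSolution.shift {z : ℝ → E} (hz : IsSolution X z) (s : ℝ) :
    IsSolution X (fun t => z (t + s)) :=
  fun t => (hz (t + s)).comp_add_const t s

theorem IsSolution.norm_sub_le (hM : ∀ z, ‖X z‖ ≤ M) {z : ℝ → E} (hz : IsSolution X z)
    (a b : ℝ) : ‖z b - z a‖ ≤ M * |b - a| :=
  norm_sub_le_of_bounded_field convex_univ hM (fun t _ => hz t) (mem_univ a) (mem_univ b)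

/-- A bounded field cannot blow up: on `[-(N+1), N+1]` Picard-Lindelöf applies in the ball of radius
`M * (N + 1)` about `p`, which no solution can leave in that time. The solutions for different `N`
agree by uniqueness and are glued. -/
theorem exists_isSolution [CompleteSpace E]
    (hL : ∀ R, ∃ K : ℝ≥0, LipschitzOnWith K X (closedBall 0 R))
    (hM : ∀ z, ‖X z‖ ≤ M) (p : E) : ∃ z : ℝ → E, z 0 = p ∧ IsSolution X z := by
  have hM0 : 0 ≤ M := (norm_nonneg _).trans (hM 0)
  have hloc : ∀ N : ℕ, ∃ z : ℝ → E, z 0 = p ∧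
      ∀ t ∈ Ioo (-((N : ℝ) + 1)) ((N : ℝ) + 1), HasDerivAt z (X (z t)) t := by
    intro N
    have hN : (0 : ℝ) < (N : ℝ) + 1 := by positivity
    obtain ⟨K, hK⟩ := hL (‖p‖ + M * ((N : ℝ) + 1))
    have hPL : IsPicardLindelof (fun _ : ℝ => X)
        (tmin := -((N : ℝ) + 1)) (tmax := (N : ℝ) + 1) ⟨0, by linarith, hN.le⟩ p
        (Real.toNNReal (M * ((N : ℝ) + 1))) 0 (Real.toNNReal M) K := by
      refine ⟨fun t _ => hK.mono fun x hx => ?_, fun x _ => continuousOn_const,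
        fun t _ x _ => (hM x).trans (Real.le_coe_toNNReal M), ?_⟩
      · rw [mem_closedBall, Real.coe_toNNReal _ (by positivity), dist_eq_norm] at hx
        rw [mem_closedBall_zero_iff]
        have := norm_add_le (x - p) p
        rw [sub_add_cancel] at this
        linarith
      · rw [Real.coe_toNNReal _ (by positivity)]
        simp
    obtain ⟨z, hz0, hz⟩ := hPL.exists_eq_forall_mem_Icc_hasDerivWithinAt₀
    exact ⟨z, hz0, fun t ht =>
      (hz t (Ioo_subset_Icc_self ht)).hasDerivAt (Icc_mem_nhds ht.1 ht.2)⟩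
  choose z hz0 hz using hloc
  have hmono : ∀ N N' : ℕ, N ≤ N' → EqOn (z N) (z N') (Ioo (-((N : ℝ) + 1)) ((N : ℝ) + 1)) := by
    intro N N' h
    have h' : (N : ℝ) ≤ N' := by exact_mod_cast h
    exact eqOn_of_solutions hL hM (by positivity) (hz N)
      (fun t ht => hz N' t ⟨by linarith [ht.1], by linarith [ht.2]⟩) (by rw [hz0, hz0])
  refine ⟨fun t => z ⌈|t|⌉₊ t, by simp [hz0], fun t => ?_⟩
  have hmem : ∀ s : ℝ, s ∈ Ioo (-((⌈|s|⌉₊ : ℝ) + 1)) ((⌈|s|⌉₊ : ℝ) + 1) := fun s =>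
    abs_lt.1 ((Nat.le_ceil |s|).trans_lt (lt_add_one _))
  -- The extra one puts `t` in the open interval `(-N, N)`, on which every index `⌈|s|⌉₊` is at most
  -- `N`; so near `t` the glued curve is the single solution `z N`.
  set N := ⌈|t|⌉₊ + 1 with hN
  have htN : t ∈ Ioo (-(N : ℝ)) N := by
    have := hmem t
    rw [hN]; push_cast; exact this
  have heq : ∀ s ∈ Ioo (-(N : ℝ)) N, z ⌈|s|⌉₊ s = z N s := fun s hs =>
    hmono _ _ (Nat.ceil_le.2 (abs_lt.2 hs).le) (hmem s)
  have hd := hz N t ⟨by linarith [htN.1], by linarith [htN.2]⟩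
  have hev : (fun s => z ⌈|s|⌉₊ s) =ᶠ[𝓝 t] z N :=
    Filter.eventually_of_mem (Ioo_mem_nhds htN.1 htN.2) heq
  rw [show X (z ⌈|t|⌉₊ t) = X (z N t) by rw [heq t htN]]
  exact hd.congr_of_eventuallyEq hev

/-- Over a step of length `h` the solution moves by at most `M * h`, so its velocity changes by at
most `K * M * h`. -/
theorem IsSolution.norm_euler_error_le {z : ℝ → E} (hz : IsSolution X z) (hM : ∀ z, ‖X z‖ ≤ M)
    {R : ℝ} {K : ℝ≥0} (hK : LipschitzOnWith K X (closedBall 0 R)) {t h : ℝ} (hh : 0 ≤ h)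
    (hR : ∀ s ∈ Icc t (t + h), z s ∈ closedBall (0 : E) R) :
    ‖z (t + h) - z t - h • X (z t)‖ ≤ K * M * h ^ 2 := by
  have hM0 : 0 ≤ M := (norm_nonneg _).trans (hM 0)
  have hd : ∀ s ∈ Icc t (t + h), HasDerivWithinAt (fun s => z s - (s - t) • X (z t))
      (X (z s) - X (z t)) (Icc t (t + h)) s := by
    intro s _
    have h1 : HasDerivAt (fun s : ℝ => (s - t) • X (z t)) ((1 : ℝ) • X (z t)) s :=
      ((hasDerivAt_id s).sub_const t).smul_const _
    rw [one_smul] at h1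
    exact ((hz s).sub h1).hasDerivWithinAt
  have hb : ∀ s ∈ Ico t (t + h), ‖X (z s) - X (z t)‖ ≤ K * M * h := by
    intro s hs
    have h1 := hK.norm_sub_le (hR s ⟨hs.1, hs.2.le⟩) (hR t ⟨le_rfl, by linarith⟩)
    have h2 := hz.norm_sub_le hM t s
    have h3 : |s - t| ≤ h := abs_le.2 ⟨by linarith [hs.1], by linarith [hs.2]⟩
    calc ‖X (z s) - X (z t)‖ ≤ K * ‖z s - z t‖ := h1
      _ ≤ K * (M * h) := by gcongr; exact h2.trans (by gcongr)
      _ = K * M * h := by ring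
  have := norm_image_sub_le_of_norm_deriv_le_segment' hd hb (t + h) ⟨by linarith, le_rfl⟩
  simp only [add_sub_cancel_left, sub_self, zero_smul, sub_zero] at this
  calc ‖z (t + h) - z t - h • X (z t)‖ = ‖z (t + h) - h • X (z t) - z t‖ := by rw [sub_right_comm]
    _ ≤ K * M * h * h := this
    _ = _ := by ring

/-- Convergence at time one of a consistent one-step method. -/
theorem IsSolution.tendsto_one_step_method
    (hL : ∀ R, ∃ K : ℝ≥0, LipschitzOnWith K X (closedBall 0 R))
    (hM : ∀ z, ‖X z‖ ≤ M) {S : ℝ → E → E}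
    (hSM : ∀ h, 0 ≤ h → ∀ p, ‖S h p - p‖ ≤ M * h)
    (hS : ∀ R, ∃ C, ∀ h ∈ Icc (0 : ℝ) 1, ∀ p ∈ closedBall (0 : E) R,
      ‖S h p - p - h • X p‖ ≤ C * h ^ 2)
    {z : ℝ → E} (hz : IsSolution X z) :
    Tendsto (fun N : ℕ => (S ((N : ℝ) + 1)⁻¹)^[N + 1] (z 0)) atTop (𝓝 (z 1)) := by
  have hM0 : 0 ≤ M := (norm_nonneg _).trans (hM 0)
  -- Up to time one, both the solution and the numerical iterates stay in this ball.
  set R := ‖z 0‖ + M with hR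
  obtain ⟨K, hK⟩ := hL R
  obtain ⟨C, hC⟩ := hS R
  -- The local error per step is `D * h ^ 2`: `C` from the scheme, `K * M` from comparing the
  -- solution with an Euler step.
  set D := |C| + K * M with hD
  have hD0 : 0 ≤ D := by positivity
  have hzR : ∀ t ∈ Icc (0 : ℝ) 1, z t ∈ closedBall (0 : E) R := by
    intro t ht
    have h1 := hz.norm_sub_le hM 0 t
    rw [sub_zero, abs_of_nonneg ht.1] at h1
    have h2 : M * t ≤ M := mul_le_of_le_one_right hM0 ht.2
    have h3 := norm_add_le (z t - z 0) (z 0)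
    rw [sub_add_cancel] at h3
    rw [mem_closedBall_zero_iff]; linarith
  have herr : ∀ N : ℕ, ‖(S ((N : ℝ) + 1)⁻¹)^[N + 1] (z 0) - z 1‖ ≤
      D * Real.exp K * ((N : ℝ) + 1)⁻¹ := by
    intro N
    set h : ℝ := ((N : ℝ) + 1)⁻¹ with hh
    have hN : (0 : ℝ) < (N : ℝ) + 1 := by positivity
    have h0 : 0 < h := inv_pos.2 hN
    have hN1 : ((N : ℝ) + 1) * h = 1 := mul_inv_cancel₀ hN.ne'
    have hh1 : h ≤ 1 := inv_le_one_of_one_le₀ (by simp)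
    have hy : ∀ k : ℕ, ‖(S h)^[k] (z 0)‖ ≤ ‖z 0‖ + M * (k * h) := by
      intro k
      induction k with
      | zero => simp
      | succ k ih =>
        rw [Function.iterate_succ_apply']
        have h1 := hSM h h0.le ((S h)^[k] (z 0))
        have h2 := norm_add_le (S h ((S h)^[k] (z 0)) - (S h)^[k] (z 0)) ((S h)^[k] (z 0))
        rw [sub_add_cancel] at h2
        push_cast
        linarith
    have hkh : ∀ k : ℕ, k ≤ N + 1 → (k : ℝ) * h ≤ 1 := by
      intro k hk
      rw [← hN1]
      gcongr
      exact_mod_cast hk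
    have hK1 : 1 ≤ 1 + (K : ℝ) * h := by have : 0 ≤ (K : ℝ) * h := by positivity
                                         linarith
    -- Discrete Grönwall: each step multiplies the accumulated error by at most `1 + K * h` and adds
    -- at most `D * h ^ 2`.
    have hind : ∀ k : ℕ, k ≤ N + 1 →
        ‖(S h)^[k] (z 0) - z (k * h)‖ ≤ D * h ^ 2 * k * (1 + K * h) ^ k := by
      intro k
      induction k with
      | zero => simp
      | succ k ih =>
        intro hk
        have ih' := ih (by omega)
        set y := (S h)^[k] (z 0) with hyd
        have hkh0 : 0 ≤ (k : ℝ) * h := by positivity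
        have hkh1 : (k : ℝ) * h + h ≤ 1 := by
          have := hkh (k + 1) hk
          push_cast at this; linarith
        have hyR : y ∈ closedBall (0 : E) R := by
          rw [mem_closedBall_zero_iff]
          refine (hy k).trans ?_
          have : M * (k * h) ≤ M * 1 := by gcongr; exact hkh k (by omega)
          linarith
        have hzk : z (k * h) ∈ closedBall (0 : E) R := hzR _ ⟨hkh0, hkh k (by omega)⟩
        have e1 : ‖S h y - y - h • X y‖ ≤ |C| * h ^ 2 :=
          (hC h ⟨h0.le, hh1⟩ y hyR).trans (by gcongr; exact le_abs_self C)
        have e2 : ‖z (k * h + h) - z (k * h) - h • X (z (k * h))‖ ≤ K * M * h ^ 2 :=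
          hz.norm_euler_error_le hM hK h0.le
            (fun s hs => hzR s ⟨hkh0.trans hs.1, hs.2.trans hkh1⟩)
        have e3 : ‖h • (X y - X (z (k * h)))‖ ≤ h * (K * ‖y - z (k * h)‖) := by
          rw [norm_smul, Real.norm_of_nonneg h0.le]
          gcongr
          exact hK.norm_sub_le hyR hzk
        have e4 : S h y - z (k * h + h) = (S h y - y - h • X y) -
            (z (k * h + h) - z (k * h) - h • X (z (k * h))) + (y - z (k * h)) +
            h • (X y - X (z (k * h))) := by rw [smul_sub]; abel
        have e5 : ‖S h y - z (k * h + h)‖ ≤ D * h ^ 2 + (1 + K * h) * ‖y - z (k * h)‖ := by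
          rw [e4]
          refine (norm_add_le _ _).trans ?_
          refine (add_le_add_left (norm_add_le _ _) _).trans ?_
          refine (add_le_add_left (add_le_add_left (_root_.norm_sub_le _ _) _) _).trans ?_
          rw [hD]
          linarith
        rw [Function.iterate_succ_apply', show ((k + 1 : ℕ) : ℝ) * h = k * h + h by push_cast; ring]
        refine e5.trans ?_
        have e6 : (1 + K * h) * ‖y - z (k * h)‖ ≤ D * h ^ 2 * k * (1 + K * h) ^ (k + 1) :=
          calc _ ≤ (1 + K * h) * (D * h ^ 2 * k * (1 + K * h) ^ k) := by gcongr
            _ = _ := by ring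
        have e7 : D * h ^ 2 ≤ D * h ^ 2 * (1 + K * h) ^ (k + 1) :=
          le_mul_of_one_le_right (by positivity) (one_le_pow₀ hK1)
        push_cast
        linarith
    have hfin := hind (N + 1) le_rfl
    have hc : ((N + 1 : ℕ) : ℝ) * h = 1 := by push_cast; exact hN1
    rw [hc] at hfin
    refine hfin.trans ?_
    have hexp : (1 + K * h) ^ (N + 1) ≤ Real.exp K := by
      calc (1 + K * h) ^ (N + 1) ≤ (Real.exp (K * h)) ^ (N + 1) := by
            gcongr; rw [add_comm]; exact Real.add_one_le_exp _
        _ = Real.exp K := by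
          rw [← Real.exp_nat_mul]; congr 1
          rw [mul_left_comm, hc, mul_one]
    calc D * h ^ 2 * ((N + 1 : ℕ) : ℝ) * (1 + K * h) ^ (N + 1)
        = D * h * (((N + 1 : ℕ) : ℝ) * h) * (1 + K * h) ^ (N + 1) := by ring
      _ ≤ D * h * 1 * Real.exp K := by rw [hc]; gcongr
      _ = _ := by ring
  rw [tendsto_iff_norm_sub_tendsto_zero]
  refine squeeze_zero (fun _ => norm_nonneg _) herr ?_
  have := tendsto_one_div_add_atTop_nhds_zero_nat (𝕜 := ℝ)
  simpa using this.const_mul (D * Real.exp K)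

end BoundedFields

/-! ### Volume preservation and Poincaré recurrence for `a' = f(b)`, `b' = g(a)`. -/

section Recurrence

open Metric Set
open scoped NNReal

/-- A pointwise limit of measure-preserving maps at bounded distance from the identity preserves
the measure. -/
theorem measurePreserving_of_tendsto {E : Type*} [NormedAddCommGroup E] [ProperSpace E]
    [MeasurableSpace E] [BorelSpace E] {μ : Measure E} [μ.Regular]
    {T : ℕ → E → E} {S : E → E} {M : ℝ} (hT : ∀ N, MeasurePreserving (T N) μ μ)
    (hM : ∀ N p, ‖T N p - p‖ ≤ M) (hlim : ∀ p, Tendsto (fun N => T N p) atTop (𝓝 (S p))) :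
    MeasurePreserving S μ μ := by
  have hSm : Measurable S :=
    measurable_of_tendsto_metrizable (fun N => (hT N).measurable) (tendsto_pi_nhds.2 hlim)
  have hSM : ∀ p, ‖S p - p‖ ≤ M := fun p =>
    le_of_tendsto ((hlim p).sub_const p).norm (Eventually.of_forall fun N => hM N p)
  have hpre : ∀ (U : E → E) (_ : ∀ p, ‖U p - p‖ ≤ M) (R : ℝ) (p : E),
      U p ∈ closedBall (0 : E) R → p ∈ closedBall (0 : E) (R + M) := by
    intro U hU R p hp
    rw [mem_closedBall_zero_iff] at hp ⊢
    have h1 := _root_.norm_sub_le (U p) (U p - p)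
    rw [sub_sub_cancel] at h1
    linarith [hU p]
  -- Finiteness on compact sets makes the image measure regular, hence determined by its integrals
  -- of compactly supported continuous functions.
  have : IsFiniteMeasureOnCompacts (μ.map S) := by
    constructor
    intro K hK
    obtain ⟨R, hR⟩ := hK.isBounded.subset_closedBall (0 : E)
    refine (measure_mono hR).trans_lt ?_
    rw [Measure.map_apply hSm measurableSet_closedBall]
    exact (measure_mono (fun p hp => hpre S hSM R p hp)).trans_lt
      (isCompact_closedBall (0 : E) (R + M)).measure_lt_top
  have : (μ.map S).Regular := inferInstance
  refine ⟨hSm, Measure.ext_of_integral_eq_on_compactlySupported fun φ => ?_⟩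
  have hφ : Continuous φ := φ.continuous
  rw [integral_map hSm.aemeasurable hφ.aestronglyMeasurable]
  obtain ⟨R, hR⟩ := φ.hasCompactSupport.isCompact.isBounded.subset_closedBall (0 : E)
  obtain ⟨C, hC⟩ := hφ.bounded_above_of_compact_support φ.hasCompactSupport
  have hlimit : Tendsto (fun N => ∫ p, φ (T N p) ∂μ) atTop (𝓝 (∫ p, φ (S p) ∂μ)) := by
    -- Each `T N` moves points by at most `M`, so all the `φ ∘ T N` vanish outside one ball of
    -- radius `R + M`.
    refine tendsto_integral_of_dominated_convergence
      ((closedBall (0 : E) (R + M)).indicator fun _ => C) (fun N => ?_) ?_ (fun N => ?_) ?_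
    · exact (hφ.measurable.comp (hT N).measurable).aestronglyMeasurable
    · exact (integrable_indicator_iff measurableSet_closedBall).2
        (integrableOn_const (isCompact_closedBall (0 : E) (R + M)).measure_lt_top.ne)
    · refine Eventually.of_forall fun p => ?_
      by_cases hp : p ∈ closedBall (0 : E) (R + M)
      · rw [indicator_of_mem hp]; exact hC _
      · have h0 : φ (T N p) = 0 :=
          image_eq_zero_of_notMem_tsupport fun h => hp (hpre (T N) (hM N) R p (hR h))
        rw [indicator_of_notMem hp, h0, norm_zero]
    · exact Eventually.of_forall fun p => (hφ.tendsto _).comp (hlim p)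
  have hconst : ∀ N, ∫ p, φ (T N p) ∂μ = ∫ p, φ p ∂μ := by
    intro N
    conv_rhs => rw [← (hT N).map_eq]
    rw [integral_map (hT N).measurable.aemeasurable hφ.aestronglyMeasurable]
  simp only [hconst] at hlimit
  exact tendsto_nhds_unique hlimit tendsto_const_nhds |>.symm ▸ rfl

/-- Poincaré recurrence for a measure-preserving map with a proper conserved quantity. -/
theorem ae_recurrent_of_conserved {E : Type*} [NormedAddCommGroup E] [ProperSpace E]
    [MeasurableSpace E] [BorelSpace E] {μ : Measure E} [IsFiniteMeasureOnCompacts μ]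
    {T : E → E} (hT : MeasurePreserving T μ μ) {H : E → ℝ} (hH : Measurable H)
    (hHT : ∀ p, H (T p) = H p) (hbdd : ∀ c, Bornology.IsBounded {p | H p ≤ c}) :
    ∀ᵐ p ∂μ, ∀ s ∈ 𝓝 p, ∃ᶠ n in atTop, T^[n] p ∈ s := by
  have hc : ∀ c : ℕ, ∀ᵐ p ∂μ, p ∈ {p | H p ≤ c} → ∀ s ∈ 𝓝 p, ∃ᶠ n in atTop, T^[n] p ∈ s := by
    intro c
    have hm : MeasurableSet {p | H p ≤ c} := measurableSet_le hH measurable_const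
    have hfin : IsFiniteMeasure (μ.restrict {p | H p ≤ c}) := by
      constructor
      rw [Measure.restrict_apply_univ]
      exact (hbdd c).measure_lt_top
    -- Invariance lets `T` be restricted to a set of finite measure, where a measure-preserving map
    -- is conservative. Countably many integer levels `c` exhaust the space.
    have hpre : T ⁻¹' {p | H p ≤ c} = {p | H p ≤ c} := by
      ext p; simp [hHT]
    have hr : MeasurePreserving T (μ.restrict {p | H p ≤ c}) (μ.restrict {p | H p ≤ c}) := by
      simpa only [hpre] using hT.restrict_preimage hm
    exact (ae_restrict_iff' hm).1 hr.conservative.ae_frequently_mem_of_mem_nhds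
  filter_upwards [ae_all_iff.2 hc] with p hp
  obtain ⟨c, hc⟩ := exists_nat_ge (H p)
  exact hp c hc

section Shear

variable {V W : Type*} [MeasurableSpace V]
  [NormedAddCommGroup W] [NormedSpace ℝ W] [FiniteDimensional ℝ W]
  [MeasurableSpace W] [BorelSpace W]
  {μ : Measure V} {ν : Measure W} [SFinite μ] [ν.IsAddHaarMeasure]

/-- On each fibre over `V` the map is a translation, under which Haar measure is invariant. -/
theorem measurePreserving_shear_right {g : V → W} (hg : Measurable g) :
    MeasurePreserving (fun p : V × W => (p.1, g p.1 + p.2)) (μ.prod ν) (μ.prod ν) := by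
  refine (MeasurePreserving.id μ).skew_product (g := fun a b => g a + b) ?_ ?_
  · exact (hg.comp measurable_fst).add measurable_snd
  · exact ae_of_all _ fun a => map_add_left_eq_self ν (g a)

theorem measurePreserving_shear_left {f : V → W} (hf : Measurable f) :
    MeasurePreserving (fun p : W × V => (f p.2 + p.1, p.2)) (ν.prod μ) (ν.prod μ) :=
  (Measure.measurePreserving_swap (μ := μ) (ν := ν)).comp
    ((measurePreserving_shear_right (μ := μ) (ν := ν) hf).comp
      (Measure.measurePreserving_swap (μ := ν) (ν := μ)))

end Shear

section CrossField

/-- The vector field of the system `a' = f(b)`, `b' = g(a)`. -/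
def crossField {V W : Type*} (f : W → V) (g : V → W) (p : V × W) : V × W := (f p.2, g p.1)

theorem norm_crossField_le {V W : Type*} [NormedAddCommGroup V] [NormedAddCommGroup W]
    {f : W → V} {g : V → W} {M : ℝ} (hfM : ∀ b, ‖f b‖ ≤ M) (hgM : ∀ a, ‖g a‖ ≤ M)
    (p : V × W) : ‖crossField f g p‖ ≤ M :=
  max_le (hfM _) (hgM _)

variable {V W : Type*} [NormedAddCommGroup V] [NormedSpace ℝ V]
  [NormedAddCommGroup W] [NormedSpace ℝ W]

/-- The symplectic Euler step of the system `a' = f(b)`, `b' = g(a)`. -/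
def symplecticEuler (f : W → V) (g : V → W) (h : ℝ) (p : V × W) : V × W :=
  (h • f p.2 + p.1, h • g (h • f p.2 + p.1) + p.2)

variable {f : W → V} {g : V → W} {M : ℝ}

theorem exists_lipschitzOnWith_closedBall [FiniteDimensional ℝ V] (hg : ContDiff ℝ 1 g) (R : ℝ) :
    ∃ K : ℝ≥0, LipschitzOnWith K g (closedBall 0 R) := by
  have := FiniteDimensional.proper ℝ V
  exact hg.contDiffOn.exists_lipschitzOnWith one_ne_zero (convex_closedBall _ _)
    (isCompact_closedBall _ _)

theorem contDiff_crossField (hf : ContDiff ℝ 1 f) (hg : ContDiff ℝ 1 g) :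
    ContDiff ℝ 1 (crossField f g) :=
  (hf.comp contDiff_snd).prodMk (hg.comp contDiff_fst)

theorem norm_symplecticEuler_sub_le (hfM : ∀ b, ‖f b‖ ≤ M) (hgM : ∀ a, ‖g a‖ ≤ M) {h : ℝ}
    (hh : 0 ≤ h) (p : V × W) : ‖symplecticEuler f g h p - p‖ ≤ M * h := by
  have : symplecticEuler f g h p - p = h • (f p.2, g (h • f p.2 + p.1)) := by
    ext <;> simp [symplecticEuler]
  rw [this, norm_smul, Real.norm_of_nonneg hh, mul_comm]
  gcongr
  exact max_le (hfM _) (hgM _)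

/-- The step differs from explicit Euler only in evaluating `g` at the updated first variable, a
shift of size at most `M * h`; the factor `h` in front of `g` makes the error quadratic. -/
theorem symplecticEuler_consistent [FiniteDimensional ℝ V] (hg : ContDiff ℝ 1 g)
    (hfM : ∀ b, ‖f b‖ ≤ M) (R : ℝ) :
    ∃ C, ∀ h ∈ Icc (0 : ℝ) 1, ∀ p ∈ closedBall (0 : V × W) R,
      ‖symplecticEuler f g h p - p - h • crossField f g p‖ ≤ C * h ^ 2 := by
  have hM0 : 0 ≤ M := (norm_nonneg _).trans (hfM 0)
  obtain ⟨K, hK⟩ := exists_lipschitzOnWith_closedBall hg (R + M)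
  refine ⟨K * M, fun h hh p hp => ?_⟩
  have h1 : symplecticEuler f g h p - p - h • crossField f g p =
      (0, h • (g (h • f p.2 + p.1) - g p.1)) := by
    ext <;> simp [symplecticEuler, crossField, smul_sub]
  have hp1 : ‖p.1‖ ≤ R := (norm_fst_le p).trans (mem_closedBall_zero_iff.1 hp)
  have h2 : ‖h • f p.2‖ ≤ M * h := by
    rw [norm_smul, Real.norm_of_nonneg hh.1, mul_comm]
    exact mul_le_mul_of_nonneg_right (hfM _) hh.1
  have h3 : M * h ≤ M := mul_le_of_le_one_right hM0 hh.2
  have h4 := hK.norm_sub_le (x := h • f p.2 + p.1) (y := p.1)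
    (mem_closedBall_zero_iff.2 ((norm_add_le _ _).trans (by linarith)))
    (mem_closedBall_zero_iff.2 (by linarith))
  rw [add_sub_cancel_right] at h4
  rw [h1, Prod.norm_mk, norm_zero, max_eq_right (norm_nonneg _), norm_smul,
    Real.norm_of_nonneg hh.1]
  calc h * ‖g (h • f p.2 + p.1) - g p.1‖ ≤ h * (K * (M * h)) :=
        mul_le_mul_of_nonneg_left (h4.trans (by gcongr)) hh.1
    _ = K * M * h ^ 2 := by ring

end CrossField

section CrossRecurrence

variable {V W : Type*} [NormedAddCommGroup V] [NormedSpace ℝ V] [FiniteDimensional ℝ V]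
  [MeasurableSpace V] [BorelSpace V]
  [NormedAddCommGroup W] [NormedSpace ℝ W] [FiniteDimensional ℝ W]
  [MeasurableSpace W] [BorelSpace W]
  {μ : Measure V} {ν : Measure W} [μ.IsAddHaarMeasure] [ν.IsAddHaarMeasure]
  {f : W → V} {g : V → W} {M : ℝ}

/-- Updating the first variable and then the second is a composition of two shears. -/
theorem measurePreserving_symplecticEuler (hf : Measurable f) (hg : Measurable g) (h : ℝ) :
    MeasurePreserving (symplecticEuler f g h) (μ.prod ν) (μ.prod ν) :=
  (measurePreserving_shear_right (hg.const_smul h)).comp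
    (measurePreserving_shear_left (hf.const_smul h))

/-- **Liouville's theorem** for the system `a' = f(b)`, `b' = g(a)`: the time-one map preserves
volume. -/
theorem measurePreserving_time_one (hf : ContDiff ℝ 1 f) (hg : ContDiff ℝ 1 g)
    (hfM : ∀ b, ‖f b‖ ≤ M) (hgM : ∀ a, ‖g a‖ ≤ M) {S : V × W → V × W}
    (hS : ∀ z, IsSolution (crossField f g) z → S (z 0) = z 1) :
    MeasurePreserving S (μ.prod ν) (μ.prod ν) := by
  have := FiniteDimensional.proper ℝ (V × W)
  have hL := exists_lipschitzOnWith_closedBall (contDiff_crossField hf hg)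
  have hM := norm_crossField_le hfM hgM
  have hh : ∀ N : ℕ, (0 : ℝ) ≤ ((N : ℝ) + 1)⁻¹ := fun N => by positivity
  refine measurePreserving_of_tendsto (M := M)
    (T := fun N => (symplecticEuler f g ((N : ℝ) + 1)⁻¹)^[N + 1])
    (fun N => (measurePreserving_symplecticEuler hf.continuous.measurable
      hg.continuous.measurable _).iterate _) (fun N p => ?_) (fun p => ?_)
  -- Each of the `N + 1` steps moves points by at most `M / (N + 1)`, so the total displacement is
  -- at most `M`, uniformly in `N`.
  · have h1 : ∀ k : ℕ, ‖(symplecticEuler f g ((N : ℝ) + 1)⁻¹)^[k] p - p‖ ≤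
        k * (M * ((N : ℝ) + 1)⁻¹) := by
      intro k
      induction k with
      | zero => simp
      | succ k ih =>
        rw [Function.iterate_succ_apply']
        set q := (symplecticEuler f g ((N : ℝ) + 1)⁻¹)^[k] p
        have h2 := norm_symplecticEuler_sub_le hfM hgM (hh N) q
        have h3 := norm_add_le (symplecticEuler f g ((N : ℝ) + 1)⁻¹ q - q) (q - p)
        rw [sub_add_sub_cancel] at h3
        push_cast
        linarith
    refine (h1 (N + 1)).trans_eq ?_
    push_cast
    field_simp
  · obtain ⟨z, rfl, hz⟩ := exists_isSolution hL hM p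
    rw [hS z hz]
    exact hz.tendsto_one_step_method hL hM
      (fun h hh p => norm_symplecticEuler_sub_le hfM hgM hh p)
      (symplecticEuler_consistent hg hfM)

/-- Poincaré recurrence of the system `a' = f(b)`, `b' = g(a)`, given a conserved quantity with
bounded sublevel sets. -/
theorem ae_recurrent_crossField (hf : ContDiff ℝ 1 f) (hg : ContDiff ℝ 1 g)
    (hfM : ∀ b, ‖f b‖ ≤ M) (hgM : ∀ a, ‖g a‖ ≤ M) {H : V × W → ℝ} (hH : Measurable H)
    (hcons : ∀ z, IsSolution (crossField f g) z → ∀ t, H (z t) = H (z 0))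
    (hbdd : ∀ c, Bornology.IsBounded {p | H p ≤ c}) :
    ∀ᵐ p ∂(μ.prod ν), ∀ z, IsSolution (crossField f g) z → z 0 = p → IsRecurrentOrbit z := by
  have := FiniteDimensional.proper ℝ (V × W)
  have hL := exists_lipschitzOnWith_closedBall (contDiff_crossField hf hg)
  have hM := norm_crossField_le hfM hgM
  choose φ hφ0 hφ using exists_isSolution hL hM
  have huniq : ∀ z, IsSolution (crossField f g) z → z = φ (z 0) := fun z hz =>
    hz.unique hL hM (hφ _) (hφ0 _).symm
  have hmp : MeasurePreserving (fun p => φ p 1) (μ.prod ν) (μ.prod ν) :=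
    measurePreserving_time_one hf hg hfM hgM fun z hz => by rw [← huniq z hz]
  have hrec := ae_recurrent_of_conserved hmp hH
    (fun p => by rw [hcons _ (hφ p) 1, hφ0]) hbdd
  filter_upwards [hrec] with p hp z hz hz0
  -- The field is autonomous, so a time-shifted solution is again a solution and uniqueness turns
  -- iterates into integer times.
  have hiter : ∀ n : ℕ, (fun p => φ p 1)^[n] p = z n := by
    intro n
    induction n with
    | zero => simp [hz0]
    | succ n ih =>
      rw [Function.iterate_succ_apply', ih]
      have h1 := huniq _ (hz.shift n)
      have h2 := congrFun h1 1
      simp only [zero_add] at h2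
      rw [← h2]
      push_cast
      rw [add_comm]
  have hcl : MapClusterPt p atTop (fun n : ℕ => z n) := by
    rw [mapClusterPt_iff_frequently]
    intro s hs
    exact (hp s hs).mono fun n hn => by rwa [hiter n] at hn
  obtain ⟨ψ, hψ, hlim⟩ := hcl.tendsto_subseq
  exact ⟨fun k => ψ k, tendsto_natCast_atTop_atTop.comp hψ.tendsto_atTop, by rwa [hz0]⟩

end CrossRecurrence

end Recurrence

/-! ### Exponentials, partition functions and Gibbs states of Hermitian matrices. -/

section Spectral

variable {n : ℕ}

theorem exists_diagonalization {A : Mat n} (hA : A.IsHermitian) :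
    ∃ (U : Mat n) (l : Fin n → ℝ), Uᴴ * U = 1 ∧ U * Uᴴ = 1 ∧
      A = U * Matrix.diagonal (fun i => (l i : ℂ)) * Uᴴ :=
  ⟨hA.eigenvectorUnitary, hA.eigenvalues,
    Unitary.coe_star_mul_self hA.eigenvectorUnitary,
    Unitary.coe_mul_star_self hA.eigenvectorUnitary, hA.spectral_theorem⟩

theorem exp_conj_diagonal {U : Mat n} (h1 : Uᴴ * U = 1) (h2 : U * Uᴴ = 1) (l : Fin n → ℝ) :
    NormedSpace.exp (U * Matrix.diagonal (fun i => (l i : ℂ)) * Uᴴ) =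
      U * Matrix.diagonal (fun i => (Real.exp (l i) : ℂ)) * Uᴴ := by
  have hinv : U⁻¹ = Uᴴ := Matrix.inv_eq_left_inv h1
  have hU : IsUnit U := ⟨⟨U, Uᴴ, h2, h1⟩, rfl⟩
  have := Matrix.exp_conj U (Matrix.diagonal (fun i => (l i : ℂ))) hU
  rw [hinv] at this
  rw [this, Matrix.exp_diagonal]
  congr 3
  funext i
  rw [Pi.coe_exp, ← Complex.exp_eq_exp_ℂ, Complex.ofReal_exp]

theorem trace_conj_unitary {U : Mat n} (h1 : Uᴴ * U = 1) (D : Mat n) :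
    (U * D * Uᴴ).trace = D.trace := by
  rw [Matrix.trace_mul_cycle, h1, Matrix.one_mul]

theorem isHermitian_conj_diagonal (U : Mat n) (l : Fin n → ℝ) :
    (U * Matrix.diagonal (fun i => (l i : ℂ)) * Uᴴ).IsHermitian := by
  refine Matrix.isHermitian_mul_mul_conjTranspose U ?_
  rw [Matrix.IsHermitian, Matrix.diagonal_conjTranspose]
  congr 1; funext i; simp

theorem posSemidef_conj_diagonal (U : Mat n) {l : Fin n → ℝ} (hl : ∀ i, 0 ≤ l i) :
    (U * Matrix.diagonal (fun i => (l i : ℂ)) * Uᴴ).PosSemidef :=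
  (Matrix.PosSemidef.diagonal fun i => by simpa using hl i).mul_mul_conjTranspose_same U

theorem conj_diagonal_sub_smul_one {U : Mat n} (h2 : U * Uᴴ = 1) (l : Fin n → ℝ) (c : ℝ) :
    U * Matrix.diagonal (fun i => (l i : ℂ)) * Uᴴ - (c : ℂ) • 1 =
      U * Matrix.diagonal (fun i => ((l i - c : ℝ) : ℂ)) * Uᴴ := by
  have : Matrix.diagonal (fun i => ((l i - c : ℝ) : ℂ)) =
      Matrix.diagonal (fun i => (l i : ℂ)) - (c : ℂ) • (1 : Mat n) := by
    ext i j
    by_cases h : i = j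
    · subst h; simp
    · simp [h]
  rw [this, Matrix.mul_sub, Matrix.sub_mul, Matrix.mul_smul, Matrix.smul_mul, Matrix.mul_one, h2]

/-- A full-rank positive semidefinite matrix is diagonalized with positive eigenvalues. -/
theorem exists_diagonalization_pos {ρ : Mat n} (hρ : ρ.PosSemidef) (hr : ρ.rank = n) :
    ∃ (U : Mat n) (l : Fin n → ℝ), Uᴴ * U = 1 ∧ U * Uᴴ = 1 ∧ (∀ i, 0 < l i) ∧
      ρ = U * Matrix.diagonal (fun i => (l i : ℂ)) * Uᴴ := by
  have hne : ∀ i, hρ.1.eigenvalues i ≠ 0 := by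
    have h1 := hρ.1.rank_eq_card_non_zero_eigs
    rw [hr] at h1
    by_contra! h
    obtain ⟨i, hi⟩ := h
    have := Fintype.card_subtype_lt (p := fun i => hρ.1.eigenvalues i ≠ 0) (x := i) (by simpa using hi)
    rw [Fintype.card_fin] at this
    omega
  exact ⟨hρ.1.eigenvectorUnitary, hρ.1.eigenvalues,
    Unitary.coe_star_mul_self hρ.1.eigenvectorUnitary,
    Unitary.coe_mul_star_self hρ.1.eigenvectorUnitary,
    fun i => lt_of_le_of_ne (hρ.eigenvalues_nonneg i) (hne i).symm, hρ.1.spectral_theorem⟩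

theorem exists_pos_smul_one_le {ρ : Mat n} (hρ : ρ.PosSemidef) (hr : ρ.rank = n) :
    ∃ ε : ℝ, 0 < ε ∧ (ρ - (ε : ℂ) • (1 : Mat n)).PosSemidef := by
  obtain ⟨U, l, h1, h2, hl, rfl⟩ := exists_diagonalization_pos hρ hr
  obtain ⟨ε, hε, hle⟩ : ∃ ε : ℝ, 0 < ε ∧ ∀ i, ε ≤ l i := by
    rcases isEmpty_or_nonempty (Fin n) with h | h
    · exact ⟨1, one_pos, fun i => h.elim i⟩
    · obtain ⟨i, hi⟩ := Finite.exists_min l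
      exact ⟨l i, hl i, hi⟩
  refine ⟨ε, hε, ?_⟩
  rw [conj_diagonal_sub_smul_one h2]
  exact posSemidef_conj_diagonal U fun i => sub_nonneg.2 (hle i)

/-- With `W = Vᴴ * U`, equality of the exponentials says `W i j * exp (l j) = exp (k i) * W i j`. So
`l j = k i` wherever `W i j ≠ 0`, and the same identity holds without the exponentials. -/
theorem exp_injective_of_isHermitian {A B : Mat n} (hA : A.IsHermitian) (hB : B.IsHermitian)
    (h : NormedSpace.exp A = NormedSpace.exp B) : A = B := by
  obtain ⟨U, l, hU1, hU2, rfl⟩ := exists_diagonalization hA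
  obtain ⟨V, k, hV1, hV2, rfl⟩ := exists_diagonalization hB
  rw [exp_conj_diagonal hU1 hU2, exp_conj_diagonal hV1 hV2] at h
  have key : ∀ D E : Mat n, U * D * Uᴴ = V * E * Vᴴ ↔ (Vᴴ * U) * D = E * (Vᴴ * U) := by
    intro D E
    constructor
    · intro h
      calc Vᴴ * U * D = Vᴴ * (U * D * Uᴴ) * U := by
            simp only [Matrix.mul_assoc, hU1, Matrix.mul_one]
        _ = Vᴴ * (V * E * Vᴴ) * U := by rw [h]
        _ = (Vᴴ * V) * E * (Vᴴ * U) := by simp only [Matrix.mul_assoc]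
        _ = E * (Vᴴ * U) := by rw [hV1, Matrix.one_mul]
    · intro h
      calc U * D * Uᴴ = V * (Vᴴ * U * D) * Uᴴ := by
            simp only [← Matrix.mul_assoc, hV2, Matrix.one_mul]
        _ = V * (E * (Vᴴ * U)) * Uᴴ := by rw [h]
        _ = V * E * Vᴴ * (U * Uᴴ) := by simp only [Matrix.mul_assoc]
        _ = V * E * Vᴴ := by rw [hU2, Matrix.mul_one]
  rw [key] at h ⊢
  ext i j
  have hij := congrFun (congrFun h i) j
  rw [Matrix.mul_diagonal, Matrix.diagonal_mul] at hij ⊢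
  rcases eq_or_ne ((Vᴴ * U) i j) 0 with h0 | h0
  · simp [h0]
  · rw [mul_comm] at hij
    have h1 := Complex.ofReal_injective (mul_right_cancel₀ h0 hij)
    rw [Real.exp_injective h1, mul_comm]

theorem exp_add_smul_one (A : Mat n) (c : ℝ) :
    NormedSpace.exp (A + (c : ℂ) • 1) = (Real.exp c : ℂ) • NormedSpace.exp A := by
  have h1 : Commute A ((c : ℂ) • (1 : Mat n)) := (Commute.one_right A).smul_right _
  have h2 : (c : ℂ) • (1 : Mat n) = Matrix.diagonal (fun _ => (c : ℂ)) := by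
    rw [← Matrix.diagonal_one, ← Matrix.diagonal_smul]; congr 1; funext i; simp
  rw [Matrix.exp_add_of_commute _ _ h1, h2, Matrix.exp_diagonal,
    show NormedSpace.exp (fun _ : Fin n => (c : ℂ)) = fun _ => (Real.exp c : ℂ) from funext fun i => by
      rw [Pi.coe_exp, ← Complex.exp_eq_exp_ℂ, Complex.ofReal_exp]]
  ext i j
  rw [Matrix.mul_diagonal, Matrix.smul_apply, smul_eq_mul, mul_comm]

/-- The partition function `Tr(exp(A))` of a Hermitian matrix. -/
def partitionFn (A : Mat n) : ℝ := (NormedSpace.exp A).trace.re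

theorem partitionFn_conj_diagonal {U : Mat n} (h1 : Uᴴ * U = 1) (h2 : U * Uᴴ = 1)
    (l : Fin n → ℝ) :
    partitionFn (U * Matrix.diagonal (fun i => (l i : ℂ)) * Uᴴ) = ∑ i, Real.exp (l i) := by
  rw [partitionFn, exp_conj_diagonal h1 h2, trace_conj_unitary h1, Matrix.trace_diagonal,
    Complex.re_sum]
  simp only [Complex.ofReal_re]

theorem trace_exp_eq_partitionFn {A : Mat n} (hA : A.IsHermitian) :
    (NormedSpace.exp A).trace = (partitionFn A : ℂ) := by
  obtain ⟨U, l, h1, h2, rfl⟩ := exists_diagonalization hA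
  rw [partitionFn_conj_diagonal h1 h2, exp_conj_diagonal h1 h2, trace_conj_unitary h1,
    Matrix.trace_diagonal, Complex.ofReal_sum]

theorem partitionFn_pos [NeZero n] {A : Mat n} (hA : A.IsHermitian) : 0 < partitionFn A := by
  obtain ⟨U, l, h1, h2, rfl⟩ := exists_diagonalization hA
  rw [partitionFn_conj_diagonal h1 h2]
  exact Finset.sum_pos (fun i _ => Real.exp_pos _) Finset.univ_nonempty

theorem gibbs_eq {A : Mat n} (hA : A.IsHermitian) :
    gibbs A = ((partitionFn A)⁻¹ : ℂ) • NormedSpace.exp A := by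
  rw [gibbs, trace_exp_eq_partitionFn hA]

theorem gibbs_isDensityMatrix [NeZero n] {A : Mat n} (hA : A.IsHermitian) :
    IsDensityMatrix (gibbs A) := by
  have hZ := partitionFn_pos hA
  rw [gibbs_eq hA]
  refine ⟨Matrix.PosSemidef.smul ?_ ?_, ?_⟩
  · obtain ⟨U, l, h1, h2, rfl⟩ := exists_diagonalization hA
    rw [exp_conj_diagonal h1 h2]
    exact posSemidef_conj_diagonal U fun i => (Real.exp_pos _).le
  · rw [← Complex.ofReal_inv]
    exact_mod_cast (inv_pos.2 hZ).le
  · rw [Matrix.trace_smul, trace_exp_eq_partitionFn hA, smul_eq_mul]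
    exact inv_mul_cancel₀ (by exact_mod_cast hZ.ne')

theorem gibbs_add_smul_one (A : Mat n) (c : ℝ) : gibbs (A + (c : ℂ) • 1) = gibbs A := by
  have h : (Real.exp c : ℂ) ≠ 0 := by exact_mod_cast (Real.exp_pos c).ne'
  rw [gibbs, gibbs, exp_add_smul_one, Matrix.trace_smul, smul_eq_mul, smul_smul, mul_inv_rev,
    mul_assoc, inv_mul_cancel₀ h, mul_one]

theorem exists_gibbs_eq {ρ : Mat n} (hρ : IsFullRankState ρ) :
    ∃ A : Mat n, A.IsHermitian ∧ gibbs A = ρ := by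
  obtain ⟨U, l, h1, h2, hl, h⟩ := exists_diagonalization_pos hρ.1.1 hρ.2
  refine ⟨_, isHermitian_conj_diagonal U (fun i => Real.log (l i)), ?_⟩
  have : NormedSpace.exp (U * Matrix.diagonal (fun i => (Real.log (l i) : ℂ)) * Uᴴ) = ρ := by
    rw [exp_conj_diagonal h1 h2, h]
    simp only [Real.exp_log (hl _)]
  rw [gibbs, this, hρ.1.2, inv_one, one_smul]

/-- Equal Gibbs states have proportional exponentials, so `A` and `B` differ by a multiple of the
identity, which the trace condition forces to be zero. -/
theorem eq_of_gibbs_eq [NeZero n] {A B : Mat n} (hA : A.IsHermitian) (hB : B.IsHermitian)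
    (htA : A.trace = 0) (htB : B.trace = 0) (h : gibbs A = gibbs B) : A = B := by
  have hZA := partitionFn_pos hA
  have hZB := partitionFn_pos hB
  have hexp : NormedSpace.exp A = NormedSpace.exp (B + (Real.log (partitionFn A / partitionFn B) : ℂ) • 1) := by
    rw [exp_add_smul_one, Real.exp_log (div_pos hZA hZB)]
    rw [gibbs_eq hA, gibbs_eq hB] at h
    have h1 : (partitionFn A : ℂ) ≠ 0 := by exact_mod_cast hZA.ne'
    have := congrArg (fun M => (partitionFn A : ℂ) • M) h
    simp only [smul_smul] at this
    rw [mul_inv_cancel₀ h1, one_smul] at this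
    rw [this, Complex.ofReal_div, div_eq_mul_inv]
  have hBc : (B + (Real.log (partitionFn A / partitionFn B) : ℂ) • (1 : Mat n)).IsHermitian := by
    refine hB.add ?_
    rw [Matrix.IsHermitian, Matrix.conjTranspose_smul, Matrix.conjTranspose_one]
    simp
  have heq := exp_injective_of_isHermitian hA hBc hexp
  have ht := congrArg Matrix.trace heq
  rw [Matrix.trace_add, htA, htB, Matrix.trace_smul, Matrix.trace_one, zero_add, smul_eq_mul,
    Fintype.card_fin] at ht
  have hn : (n : ℂ) ≠ 0 := by exact_mod_cast NeZero.ne n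
  have hc := (mul_eq_zero.1 ht.symm).resolve_right hn
  rw [hc, zero_smul, add_zero] at heq
  exact heq

/-- Coercivity of `log Tr(exp(A)) - Tr(ρ A)` on traceless Hermitian matrices, for `ρ ≥ ε`. -/
theorem log_partitionFn_sub_bounds [NeZero n] {ρ : Mat n} (ht : ρ.trace = 1) {ε : ℝ} (hε : 0 < ε)
    (hρε : (ρ - (ε : ℂ) • (1 : Mat n)).PosSemidef) {A : Mat n} (hA : A.IsHermitian)
    (htA : A.trace = 0) :
    0 ≤ Real.log (partitionFn A) - (ρ * A).trace.re ∧
    (A * A).trace.re ≤ n * ((Real.log (partitionFn A) - (ρ * A).trace.re) / ε) ^ 2 := by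
  obtain ⟨U, l, h1, h2, rfl⟩ := exists_diagonalization hA
  set D : Mat n := Matrix.diagonal (fun i => (l i : ℂ)) with hD
  -- The diagonal of `ρ` in an eigenbasis of `A`: a probability vector with all weights at least
  -- `ε`.
  set p : Fin n → ℝ := fun i => ((Uᴴ * ρ * U) i i).re with hp
  have hpε : ∀ i, ε ≤ p i := by
    intro i
    have h3 := hρε.conjTranspose_mul_mul_same U
    rw [Matrix.mul_sub, Matrix.sub_mul, Matrix.mul_smul, Matrix.smul_mul, Matrix.mul_one, h1] at h3
    have h4 := (Complex.le_def.1 (h3.diag_nonneg (i := i))).1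
    simp at h4
    exact h4
  have hpsum : ∑ i, p i = 1 := by
    have : (Uᴴ * ρ * U).trace = 1 := by rw [Matrix.trace_mul_cycle, h2, Matrix.one_mul, ht]
    have h3 := congrArg Complex.re this
    rw [Matrix.trace, Complex.re_sum] at h3
    exact h3
  have htr : (ρ * (U * D * Uᴴ)).trace.re = ∑ i, p i * l i := by
    have : (ρ * (U * D * Uᴴ)).trace = (Uᴴ * ρ * U * D).trace := by
      rw [← Matrix.mul_assoc, Matrix.trace_mul_comm]
      simp only [Matrix.mul_assoc]
    rw [this, Matrix.trace, Complex.re_sum]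
    refine Finset.sum_congr rfl fun i _ => ?_
    rw [Matrix.diag_apply, hD, Matrix.mul_diagonal, Complex.re_mul_ofReal]
  have hsum0 : ∑ i, l i = 0 := by
    rw [trace_conj_unitary h1, hD, Matrix.trace_diagonal] at htA
    exact_mod_cast htA
  obtain ⟨i0, hi0⟩ := Finite.exists_max l
  obtain ⟨j0, hj0⟩ := Finite.exists_min l
  set F := Real.log (partitionFn (U * D * Uᴴ)) - (ρ * (U * D * Uᴴ)).trace.re with hF
  -- `log Tr(exp(A))` is at least the largest eigenvalue `l i0`, and the weights sum to one.
  have hF1 : ∑ i, p i * (l i0 - l i) ≤ F := by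
    have h3 : l i0 ≤ Real.log (partitionFn (U * D * Uᴴ)) := by
      rw [hD, partitionFn_conj_diagonal h1 h2, Real.le_log_iff_exp_le]
      · exact Finset.single_le_sum (f := fun i => Real.exp (l i)) (fun i _ => (Real.exp_pos _).le)
          (Finset.mem_univ i0)
      · exact Finset.sum_pos (fun i _ => Real.exp_pos _) Finset.univ_nonempty
    simp only [mul_sub, Finset.sum_sub_distrib, ← Finset.sum_mul, hpsum, one_mul]
    rw [hF, htr]
    linarith
  have hterm : ∀ i, 0 ≤ p i * (l i0 - l i) := fun i =>
    mul_nonneg (hε.le.trans (hpε i)) (sub_nonneg.2 (hi0 i))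
  -- Keeping only the term of the smallest eigenvalue bounds the spread of the spectrum by `F / ε`.
  -- Since the trace is zero, `0` lies between the extreme eigenvalues, so each has absolute value
  -- at most `F / ε`.
  have hF2 : ε * (l i0 - l j0) ≤ F := by
    refine le_trans ?_ ((Finset.single_le_sum (fun i _ => hterm i) (Finset.mem_univ j0)).trans hF1)
    exact mul_le_mul_of_nonneg_right (hpε j0) (sub_nonneg.2 (hi0 j0))
  refine ⟨(Finset.sum_nonneg fun i _ => hterm i).trans hF1, ?_⟩
  have hcard : (0 : ℝ) < n := by exact_mod_cast Nat.pos_of_ne_zero (NeZero.ne n)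
  have hmax : 0 ≤ l i0 := by
    have : ∑ i, l i ≤ ∑ _i : Fin n, l i0 := Finset.sum_le_sum fun i _ => hi0 i
    rw [hsum0, Finset.sum_const, Finset.card_univ, Fintype.card_fin, nsmul_eq_mul] at this
    exact nonneg_of_mul_nonneg_right this hcard
  have hmin : l j0 ≤ 0 := by
    have : ∑ _i : Fin n, l j0 ≤ ∑ i, l i := Finset.sum_le_sum fun i _ => hj0 i
    rw [hsum0, Finset.sum_const, Finset.card_univ, Fintype.card_fin, nsmul_eq_mul] at this
    by_contra! h
    nlinarith
  have hdiff : l i0 - l j0 ≤ F / ε := by rw [le_div_iff₀ hε]; linarith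
  have hAA : (U * D * Uᴴ * (U * D * Uᴴ)).trace.re = ∑ i, l i ^ 2 := by
    have : U * D * Uᴴ * (U * D * Uᴴ) = U * (D * D) * Uᴴ := by
      calc U * D * Uᴴ * (U * D * Uᴴ) = U * D * (Uᴴ * U) * D * Uᴴ := by
            simp only [Matrix.mul_assoc]
        _ = _ := by rw [h1, Matrix.mul_one, Matrix.mul_assoc U D D]
    rw [this, trace_conj_unitary h1, hD, Matrix.diagonal_mul_diagonal, Matrix.trace_diagonal,
      Complex.re_sum]
    refine Finset.sum_congr rfl fun i _ => ?_
    rw [← Complex.ofReal_mul, Complex.ofReal_re, sq]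
  rw [hAA]
  calc ∑ i, l i ^ 2 ≤ ∑ _i : Fin n, (F / ε) ^ 2 := by
        refine Finset.sum_le_sum fun i _ => sq_le_sq' ?_ ?_
        · linarith [hj0 i]
        · linarith [hi0 i]
    _ = n * (F / ε) ^ 2 := by simp

end Spectral

section LinearMaps

variable {E F : Type*} [NormedAddCommGroup E] [NormedSpace ℝ E] [FiniteDimensional ℝ E]
  [NormedAddCommGroup F] [NormedSpace ℝ F]

theorem contDiff_linearMap (L : E →ₗ[ℝ] F) : ContDiff ℝ 1 L :=
  (LinearMap.toContinuousLinearMap L).contDiff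

theorem hasDerivAt_linearMap_comp (L : E →ₗ[ℝ] F) {f : ℝ → E} {f' : E} {t : ℝ}
    (hf : HasDerivAt f f' t) : HasDerivAt (fun s => L (f s)) (L f') t :=
  (LinearMap.toContinuousLinearMap L).hasFDerivAt.comp_hasDerivAt t hf

theorem exists_norm_linearMap_le (L : E →ₗ[ℝ] F) : ∃ C, ∀ x, ‖x‖ ≤ 1 → ‖L x‖ ≤ C :=
  ⟨_, fun x hx => (LinearMap.toContinuousLinearMap L).unit_le_opNorm x hx⟩

end LinearMaps

/-! ### Derivative of the partition function, and traceless log-coordinates with the Hilbert-Schmidt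
norm. -/

section FrobeniusNorm

open scoped Matrix.Norms.Frobenius

variable {n : ℕ}

theorem frobenius_norm_sq (A : Mat n) : ‖A‖ ^ 2 = (Aᴴ * A).trace.re := by
  have h : (Aᴴ * A).trace.re = ∑ i, ∑ j, ‖A i j‖ ^ 2 := by
    rw [Matrix.trace, Complex.re_sum, Finset.sum_comm]
    refine Finset.sum_congr rfl fun j _ => ?_
    rw [Matrix.diag_apply, Matrix.mul_apply, Complex.re_sum]
    refine Finset.sum_congr rfl fun i _ => ?_
    rw [Matrix.conjTranspose_apply, ← Complex.normSq_eq_norm_sq, Complex.star_def,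
      ← Complex.normSq_eq_conj_mul_self, Complex.ofReal_re]
  rw [h, Matrix.frobenius_norm_def, ← Real.sqrt_eq_rpow, Real.sq_sqrt (by positivity)]
  simp

theorem conj_diagonal_eq_mul_conjTranspose (U : Mat n) {l : Fin n → ℝ} (hl : ∀ i, 0 ≤ l i) :
    U * Matrix.diagonal (fun i => (l i : ℂ)) * Uᴴ =
      (U * Matrix.diagonal (fun i => (Real.sqrt (l i) : ℂ))) *
        (U * Matrix.diagonal (fun i => (Real.sqrt (l i) : ℂ)))ᴴ := by
  have h : Matrix.diagonal (fun i => (l i : ℂ)) =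
      Matrix.diagonal (fun i => (Real.sqrt (l i) : ℂ)) *
        (Matrix.diagonal (fun i => (Real.sqrt (l i) : ℂ)))ᴴ := by
    rw [Matrix.diagonal_conjTranspose, Matrix.diagonal_mul_diagonal]
    congr 1
    funext i
    rw [Pi.star_apply, Complex.star_def, Complex.conj_ofReal, ← Complex.ofReal_mul,
      Real.mul_self_sqrt (hl i)]
  rw [Matrix.conjTranspose_mul, Matrix.mul_assoc U (Matrix.diagonal fun i => (√(l i) : ℂ)),
    ← Matrix.mul_assoc (Matrix.diagonal _), ← h, ← Matrix.mul_assoc]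

/-- Writing `ρ = B * Bᴴ`, submultiplicativity gives `‖ρ‖ ≤ ‖B‖ ^ 2`, which is the trace. -/
theorem norm_le_trace_of_posSemidef {ρ : Mat n} (hρ : ρ.PosSemidef) : ‖ρ‖ ≤ ρ.trace.re := by
  obtain ⟨B, rfl⟩ : ∃ B : Mat n, ρ = B * Bᴴ :=
    ⟨_, hρ.1.spectral_theorem.trans
      (conj_diagonal_eq_mul_conjTranspose _ hρ.eigenvalues_nonneg)⟩
  rw [Matrix.trace_mul_comm, ← frobenius_norm_sq, sq]
  exact (Matrix.frobenius_norm_mul _ _).trans_eq (by rw [Matrix.frobenius_norm_conjTranspose])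

theorem norm_le_one_of_isDensityMatrix {ρ : Mat n} (hρ : IsDensityMatrix ρ) : ‖ρ‖ ≤ 1 := by
  simpa [hρ.2] using norm_le_trace_of_posSemidef hρ.1

theorem contDiff_matrix_exp : ContDiff ℝ 1 (NormedSpace.exp : Mat n → Mat n) :=
  contDiff_iff_contDiffAt.2 fun x => (NormedSpace.exp_analytic (𝕂 := ℝ) x).contDiffAt

/-- The real part of the trace, as a real-linear functional. -/
def reTrace (n : ℕ) : Mat n →ₗ[ℝ] ℝ :=
  Complex.reLm.comp (Matrix.traceLinearMap (Fin n) ℝ ℂ)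

/-- Under the trace, cyclicity gathers the powers of `M` on one side of `Y`. The commuting factor
`C` is there for the induction, which replaces it by a product with `M`; only `C = 1` is needed
afterwards. For `N = 0` the truncated exponent is harmless, its coefficient being zero. -/
theorem exists_hasFDerivAt_pow (M : Mat n) (N : ℕ) : ∃ D : Mat n →L[ℝ] Mat n,
    HasFDerivAt (fun M : Mat n => M ^ N) D M ∧
      ∀ C Y : Mat n, Commute C M → (C * D Y).trace = N * (C * M ^ (N - 1) * Y).trace := by
  induction N with
  | zero => exact ⟨0, by simpa using hasFDerivAt_const (1 : Mat n) M, fun C Y _ => by simp⟩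
  | succ N ih =>
    obtain ⟨D, hD, hDt⟩ := ih
    refine ⟨_, (hD.mul' (hasFDerivAt_id M)).congr_of_eventuallyEq
      (Eventually.of_forall fun M => pow_succ M N), fun C Y hC => ?_⟩
    have h1 : (C * (D Y * M)).trace = N * (C * M ^ N * Y).trace := by
      rw [← Matrix.mul_assoc, Matrix.trace_mul_comm, ← Matrix.mul_assoc,
        hDt _ _ ((Commute.refl M).mul_left hC), ← hC.eq, Matrix.mul_assoc C M]
      rcases N with _ | N
      · simp
      · rw [Nat.add_sub_cancel, ← pow_succ']
    change (C * (M ^ N * Y + D Y * M)).trace = _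
    rw [Matrix.mul_add, Matrix.trace_add]
    rw [h1, ← Matrix.mul_assoc, Nat.add_sub_cancel]
    push_cast
    ring

/-- The derivative of `Tr(exp)` at `A` is `X ↦ Tr(exp(A) X)`. -/
theorem trace_fderiv_exp (A X : Mat n) :
    (fderiv ℝ (NormedSpace.exp : Mat n → Mat n) A X).trace.re =
      (NormedSpace.exp A * X).trace.re := by
  set D := fderiv ℝ (NormedSpace.exp : Mat n → Mat n) with hD
  have hdiff : ∀ B : Mat n, HasFDerivAt (NormedSpace.exp : Mat n → Mat n) (D B) B := fun B =>
    (contDiff_matrix_exp.differentiable one_ne_zero B).hasFDerivAt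
  set G : Mat n → ℝ := fun h =>
    (NormedSpace.exp A * NormedSpace.exp (-h) * D h X).trace.re with hG
  have hDc : Continuous D := contDiff_matrix_exp.continuous_fderiv one_ne_zero
  have hGc : Continuous G := by
    have h1 : Continuous fun h : Mat n => NormedSpace.exp A * NormedSpace.exp (-h) * D h X :=
      (continuous_const.mul (contDiff_matrix_exp.continuous.comp continuous_neg)).mul
        (hDc.clm_apply continuous_const)
    exact (contDiff_linearMap (reTrace n)).continuous.comp h1
  -- Write `exp A` as the `(N + 1)`-st power of `exp h` with `h = A / (N + 1)`. The power rule under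
  -- the trace leaves `(exp h) ^ N`, which is `exp A * exp (-h)`, and the factors `N + 1` cancel. As
  -- `N → ∞`, `h → 0`, where the derivative of `exp` is the identity.
  have hconst : ∀ N : ℕ, G (((N : ℝ) + 1)⁻¹ • A) = (D A X).trace.re := by
    intro N
    set h : Mat n := ((N : ℝ) + 1)⁻¹ • A with hh
    have hN : (N : ℝ) + 1 ≠ 0 := by positivity
    have hpow : ∀ B : Mat n,
        NormedSpace.exp B = (NormedSpace.exp (((N : ℝ) + 1)⁻¹ • B)) ^ (N + 1) := by
      intro B
      rw [← Matrix.exp_nsmul, ← Nat.cast_smul_eq_nsmul ℝ, smul_smul]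
      push_cast
      rw [mul_inv_cancel₀ hN, one_smul]
    obtain ⟨P, hP, hPt⟩ := exists_hasFDerivAt_pow (NormedSpace.exp h) (N + 1)
    have hs : HasFDerivAt (fun B : Mat n => ((N : ℝ) + 1)⁻¹ • B)
        (((N : ℝ) + 1)⁻¹ • ContinuousLinearMap.id ℝ (Mat n)) A :=
      (((N : ℝ) + 1)⁻¹ • ContinuousLinearMap.id ℝ (Mat n)).hasFDerivAt
    have hcomp := (hP.comp A ((hdiff h).comp A hs)).congr_of_eventuallyEq
      (Eventually.of_forall fun B => hpow B)
    have hDA := (hdiff A).unique hcomp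
    have hexp : NormedSpace.exp A * NormedSpace.exp (-h) = NormedSpace.exp h ^ N := by
      have h1 : NormedSpace.exp h * NormedSpace.exp (-h) = 1 := by
        rw [← Matrix.exp_add_of_commute _ _ (Commute.neg_right (Commute.refl h)), add_neg_cancel,
          NormedSpace.exp_zero]
      rw [hpow A, pow_succ, Matrix.mul_assoc, h1, Matrix.mul_one]
    have h3 : D A X = P (D h (((N : ℝ) + 1)⁻¹ • X)) := by
      rw [hDA]; rfl
    have h4 : D A X = ((N : ℝ) + 1)⁻¹ • P (D h X) := by
      rw [h3, map_smul, map_smul]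
    have h5 : (P (D h X)).trace = ((N + 1 : ℕ) : ℂ) * (NormedSpace.exp h ^ N * D h X).trace := by
      simpa using hPt 1 (D h X) (Commute.one_left _)
    change (NormedSpace.exp A * NormedSpace.exp (-h) * D h X).trace.re = _
    rw [hexp, h4, Matrix.trace_smul, h5, Complex.real_smul]
    push_cast
    rw [← mul_assoc, inv_mul_cancel₀ (by exact_mod_cast hN), one_mul]
  have hlim : Tendsto (fun N : ℕ => G (((N : ℝ) + 1)⁻¹ • A)) atTop (𝓝 (G 0)) := by
    refine (hGc.tendsto 0).comp ?_
    have := (tendsto_one_div_add_atTop_nhds_zero_nat (𝕜 := ℝ)).smul_const A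
    simpa using this
  simp only [hconst] at hlim
  have h0 := tendsto_nhds_unique hlim tendsto_const_nhds
  have hD0 : D 0 = 1 := (hdiff 0).unique hasFDerivAt_exp_zero
  rw [← h0, hG]
  simp [hD0]

theorem hasDerivAt_log_partitionFn [NeZero n] {A : ℝ → Mat n} {A' : Mat n} {t : ℝ}
    (hA : (A t).IsHermitian) (hd : HasDerivAt A A' t) :
    HasDerivAt (fun s => Real.log (partitionFn (A s))) (gibbs (A t) * A').trace.re t := by
  have h1 : HasDerivAt (fun s => NormedSpace.exp (A s))
      (fderiv ℝ (NormedSpace.exp : Mat n → Mat n) (A t) A') t :=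
    (contDiff_matrix_exp.differentiable one_ne_zero (A t)).hasFDerivAt.comp_hasDerivAt t hd
  have h2 : HasDerivAt (fun s => partitionFn (A s))
      (fderiv ℝ (NormedSpace.exp : Mat n → Mat n) (A t) A').trace.re t :=
    hasDerivAt_linearMap_comp (reTrace n) h1
  rw [trace_fderiv_exp] at h2
  convert h2.log (partitionFn_pos hA).ne' using 1
  rw [gibbs_eq hA, Matrix.smul_mul, Matrix.trace_smul, ← Complex.ofReal_inv, smul_eq_mul,
    Complex.re_ofReal_mul, div_eq_inv_mul]

theorem contDiff_partitionFn : ContDiff ℝ 1 (partitionFn : Mat n → ℝ) :=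
  (contDiff_linearMap (reTrace n)).comp contDiff_matrix_exp

/-- The real space of traceless Hermitian matrices with the Hilbert-Schmidt norm. -/
def LogCoord (n : ℕ) : Type := tracelessHermitian n

instance (n : ℕ) : NormedAddCommGroup (LogCoord n) :=
  inferInstanceAs (NormedAddCommGroup (tracelessHermitian n))

instance (n : ℕ) : NormedSpace ℝ (LogCoord n) :=
  inferInstanceAs (NormedSpace ℝ (tracelessHermitian n))

instance (n : ℕ) : FiniteDimensional ℝ (LogCoord n) :=
  inferInstanceAs (FiniteDimensional ℝ (tracelessHermitian n))

/-- The matrix underlying an element of `LogCoord n`. -/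
def LogCoord.mat {n : ℕ} : LogCoord n →ₗ[ℝ] Mat n := (tracelessHermitian n).subtype

theorem LogCoord.isHermitian (a : LogCoord n) : a.mat.IsHermitian := Subtype.prop (p := _) a |>.1

theorem LogCoord.trace_eq_zero (a : LogCoord n) : a.mat.trace = 0 := Subtype.prop (p := _) a |>.2

theorem LogCoord.mat_injective : Function.Injective (LogCoord.mat (n := n)) :=
  Subtype.val_injective

theorem LogCoord.norm_mat (a : LogCoord n) : ‖a.mat‖ = ‖a‖ := rfl

theorem contDiff_gibbs [NeZero n] : ContDiff ℝ 1 (fun a : LogCoord n => gibbs a.mat) := by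
  have hc : ContDiff ℝ 1 (fun a : LogCoord n => a.mat) := contDiff_linearMap LogCoord.mat
  have h : (fun a : LogCoord n => gibbs a.mat) =
      fun a : LogCoord n => (partitionFn a.mat)⁻¹ • NormedSpace.exp a.mat := by
    funext a
    rw [gibbs_eq a.isHermitian, ← Complex.ofReal_inv]
    rfl
  rw [h]
  have h1 : ContDiff ℝ 1 (fun a : LogCoord n => partitionFn a.mat) := contDiff_partitionFn.comp hc
  have h2 : ContDiff ℝ 1 (fun a : LogCoord n => NormedSpace.exp a.mat) :=
    contDiff_matrix_exp.comp hc
  exact (h1.inv fun a => (partitionFn_pos a.isHermitian).ne').smul h2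

/-- The traceless Hermitian part of a matrix. -/
def tracelessPart (n : ℕ) : Mat n →ₗ[ℝ] LogCoord n where
  toFun X := ⟨(1 / 2 : ℝ) • (X + Xᴴ) - ((X.trace.re / n : ℝ) : ℂ) • (1 : Mat n), by
    constructor
    · refine Matrix.IsHermitian.sub ?_ ?_
      · rw [Matrix.IsHermitian, Matrix.conjTranspose_smul, Matrix.conjTranspose_add,
          Matrix.conjTranspose_conjTranspose, star_trivial, add_comm]
      · rw [Matrix.IsHermitian, Matrix.conjTranspose_smul, Matrix.conjTranspose_one,
          Complex.star_def, Complex.conj_ofReal]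
    · rcases Nat.eq_zero_or_pos n with rfl | hn
      · simp
      · have hn' : (n : ℂ) ≠ 0 := by exact_mod_cast hn.ne'
        rw [Matrix.trace_sub, Matrix.trace_smul, Matrix.trace_add,
          Matrix.trace_conjTranspose, Matrix.trace_smul, Matrix.trace_one, Fintype.card_fin,
          Complex.star_def, Complex.add_conj, Complex.real_smul, smul_eq_mul]
        push_cast
        field_simp
        ring⟩
  map_add' X Y := by
    apply LogCoord.mat_injective
    change (1 / 2 : ℝ) • (X + Y + (X + Y)ᴴ) - (((X + Y).trace.re / n : ℝ) : ℂ) • (1 : Mat n) =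
      ((1 / 2 : ℝ) • (X + Xᴴ) - ((X.trace.re / n : ℝ) : ℂ) • (1 : Mat n)) +
        ((1 / 2 : ℝ) • (Y + Yᴴ) - ((Y.trace.re / n : ℝ) : ℂ) • (1 : Mat n))
    simp only [Matrix.conjTranspose_add, Matrix.trace_add, Complex.add_re,
      add_div, Complex.ofReal_add, add_smul, smul_add]
    abel
  map_smul' c X := by
    apply LogCoord.mat_injective
    change (1 / 2 : ℝ) • (c • X + (c • X)ᴴ) - (((c • X).trace.re / n : ℝ) : ℂ) • (1 : Mat n) =
      c • ((1 / 2 : ℝ) • (X + Xᴴ) - ((X.trace.re / n : ℝ) : ℂ) • (1 : Mat n))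
    rw [Matrix.conjTranspose_smul, star_trivial, ← smul_add,
      Matrix.trace_smul, Complex.smul_re, smul_eq_mul, mul_div_assoc,
      Complex.ofReal_mul, mul_smul, Complex.coe_smul, smul_sub,
      smul_comm c (1 / 2 : ℝ), smul_comm c _ (1 : Mat n)]

theorem mat_tracelessPart {X : Mat n} (hX : X.IsHermitian) :
    (tracelessPart n X).mat = X - ((X.trace.re / n : ℝ) : ℂ) • (1 : Mat n) := by
  change (1 / 2 : ℝ) • (X + Xᴴ) - ((X.trace.re / n : ℝ) : ℂ) • (1 : Mat n) = _
  rw [hX.eq, ← two_smul ℝ X, smul_smul]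
  norm_num

theorem tracelessPart_mat (a : LogCoord n) : tracelessPart n a.mat = a := by
  apply LogCoord.mat_injective
  rw [mat_tracelessPart a.isHermitian, a.trace_eq_zero]
  simp

theorem tracelessPart_smul_one (c : ℝ) : tracelessPart n ((c : ℂ) • (1 : Mat n)) = 0 := by
  have h : ((c : ℂ) • (1 : Mat n)).IsHermitian := by
    rw [Matrix.IsHermitian, Matrix.conjTranspose_smul, Matrix.conjTranspose_one,
      Complex.star_def, Complex.conj_ofReal]
  apply LogCoord.mat_injective
  rw [mat_tracelessPart h, map_zero, sub_eq_zero]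
  rcases Nat.eq_zero_or_pos n with rfl | hn
  · exact Subsingleton.elim _ _
  · have hn' : (n : ℝ) ≠ 0 := by exact_mod_cast hn.ne'
    rw [Matrix.trace_smul, Matrix.trace_one, Fintype.card_fin, smul_eq_mul,
      Complex.re_ofReal_mul, Complex.natCast_re, mul_div_cancel_right₀ _ hn']

theorem gibbs_tracelessPart {X : Mat n} (hX : X.IsHermitian) :
    gibbs (tracelessPart n X).mat = gibbs X := by
  rw [mat_tracelessPart hX, sub_eq_add_neg, ← neg_smul, ← Complex.ofReal_neg,
    gibbs_add_smul_one]

end FrobeniusNorm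

/-! ### Linear functionals extremal at a full-rank density matrix. -/

section DensityMatrices

variable {n : ℕ}

theorem neZero_of_isDensityMatrix {ρ : Mat n} (hρ : IsDensityMatrix ρ) : NeZero n := by
  refine ⟨?_⟩
  rintro rfl
  have := hρ.2
  simp at this

theorem IsDensityMatrix.one_sub_posSemidef {ρ : Mat n} (hρ : IsDensityMatrix ρ) :
    (1 - ρ).PosSemidef := by
  obtain ⟨hp, ht⟩ := hρ
  have h1 : ∑ i, hp.1.eigenvalues i = 1 := by
    have := congrArg Complex.re hp.1.trace_eq_sum_eigenvalues
    rw [ht, Complex.re_sum] at this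
    simpa using this.symm
  have h2 : ∀ i, hp.1.eigenvalues i ≤ 1 := fun i => by
    rw [← h1]
    exact Finset.single_le_sum (fun i _ => hp.eigenvalues_nonneg i) (Finset.mem_univ i)
  have h3 := posSemidef_conj_diagonal (hp.1.eigenvectorUnitary : Mat n)
    (l := fun i => -(hp.1.eigenvalues i - 1)) (fun i => by linarith [h2 i])
  have h4 := conj_diagonal_sub_smul_one (Unitary.coe_mul_star_self hp.1.eigenvectorUnitary)
    hp.1.eigenvalues 1
  have h5 : (hp.1.eigenvectorUnitary : Mat n) *
      Matrix.diagonal (fun i => (hp.1.eigenvalues i : ℂ)) *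
      (hp.1.eigenvectorUnitary : Mat n)ᴴ = ρ := hp.1.spectral_theorem.symm
  rw [h5] at h4
  have h6 : Matrix.diagonal (fun i => ((-(hp.1.eigenvalues i - 1) : ℝ) : ℂ)) =
      -Matrix.diagonal (fun i => ((hp.1.eigenvalues i - 1 : ℝ) : ℂ)) := by
    rw [Matrix.diagonal_neg]
    congr 1
    funext i
    push_cast
    rfl
  rw [h6, Matrix.mul_neg, Matrix.neg_mul, ← h4] at h3
  simpa using h3

/-- A real-linear functional maximized over the density matrices at a full-rank one is constant on
the density matrices. -/
theorem eq_of_isMax_of_fullRank {ρs : Mat n} (hs : IsDensityMatrix ρs) (hr : ρs.rank = n)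
    (L : Mat n →ₗ[ℝ] ℝ) (hmax : ∀ ρ, IsDensityMatrix ρ → L ρ ≤ L ρs) {ρ : Mat n}
    (hρ : IsDensityMatrix ρ) : L ρ = L ρs := by
  obtain ⟨ε, hε, hpos⟩ := exists_pos_smul_one_le hs.1 hr
  refine le_antisymm (hmax ρ hρ) ?_
  -- The segment from `ρ` to `ρs` extends beyond `ρs`, since this matrix is `(ρs - ε) + ε (1 - ρ) +
  -- ε ρs`. If `L ρ < L ρs`, then `L` would exceed its maximum there.
  have hd : IsDensityMatrix (ρs + ε • (ρs - ρ)) := by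
    constructor
    · have h0 : (0 : ℂ) ≤ (ε : ℂ) := by exact_mod_cast hε.le
      have := (hpos.add ((hρ.one_sub_posSemidef).smul h0)).add (hs.1.smul h0)
      convert this using 1
      rw [← Complex.coe_smul, smul_sub, smul_sub]
      abel
    · rw [Matrix.trace_add, Matrix.trace_smul, Matrix.trace_sub, hs.2, hρ.2]
      simp
  have h1 := hmax _ hd
  rw [map_add, map_smul, map_sub, smul_eq_mul] at h1
  by_contra! h
  nlinarith

end DensityMatrices

/-! ### The payoff at a fully mixed equilibrium, and the replicator field in log-coordinates. -/

namespace ZeroSumGame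

variable {n m : ℕ} (G : ZeroSumGame n m)

/-- The payoff as a linear functional of Alice's state. -/
def payoffLeft (σ : Mat m) : Mat n →ₗ[ℝ] ℝ where
  toFun ρ := G.payoff ρ σ
  map_add' ρ ρ' := by
    simp only [payoff, hsInner, Matrix.add_kronecker, Matrix.trace_add,
      Complex.add_re, mul_add, Finset.sum_add_distrib]
  map_smul' c ρ := by
    simp only [payoff, hsInner, Matrix.smul_kronecker, Matrix.mul_smul, Matrix.trace_smul,
      Complex.smul_re, smul_eq_mul, Finset.mul_sum, RingHom.id_apply, mul_left_comm]

/-- The payoff as a linear functional of Bob's state. -/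
def payoffRight (ρ : Mat n) : Mat m →ₗ[ℝ] ℝ where
  toFun σ := G.payoff ρ σ
  map_add' σ σ' := by
    simp only [payoff, hsInner, Matrix.kronecker_add, Matrix.trace_add,
      Complex.add_re, mul_add, Finset.sum_add_distrib]
  map_smul' c σ := by
    simp only [payoff, hsInner, Matrix.kronecker_smul, Matrix.mul_smul, Matrix.trace_smul,
      Complex.smul_re, smul_eq_mul, Finset.mul_sum, RingHom.id_apply, mul_left_comm]

variable {G}

theorem IsNash.payoff_left_eq {ρs : Mat n} {σs : Mat m} (h : G.IsNash ρs σs) (hr : ρs.rank = n)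
    {ρ : Mat n} (hρ : IsDensityMatrix ρ) : G.payoff ρ σs = G.payoff ρs σs :=
  eq_of_isMax_of_fullRank h.1 hr (G.payoffLeft σs) h.2.2.1 hρ

theorem IsNash.payoff_right_eq {ρs : Mat n} {σs : Mat m} (h : G.IsNash ρs σs) (hr : σs.rank = m)
    {σ : Mat m} (hσ : IsDensityMatrix σ) : G.payoff ρs σ = G.payoff ρs σs :=
  neg_injective (eq_of_isMax_of_fullRank h.2.1 hr (-G.payoffRight ρs)
    (fun σ hσ => neg_le_neg (h.2.2.2 σ hσ)) hσ)

variable (G)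

theorem payoffObservable_isHermitian : G.payoffObservable.IsHermitian := by
  rw [payoffObservable, Matrix.IsHermitian, Matrix.conjTranspose_sum]
  refine Finset.sum_congr rfl fun a _ => ?_
  rw [Matrix.conjTranspose_smul, (G.measurement_posSemidef a).isHermitian.eq, Complex.star_def,
    Complex.conj_ofReal]

theorem superOp_apply (σ : Mat m) (i i' : Fin n) :
    G.superOp σ i i' = ∑ j, ∑ l, G.payoffObservable (i, j) (i', l) * σ l j := by
  simp only [superOp, partialTraceB, Matrix.of_apply, Matrix.mul_apply,
    Matrix.kroneckerMap_apply, Fintype.sum_prod_type, Matrix.one_apply, ite_mul, one_mul, zero_mul,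
    mul_ite, mul_zero]
  refine Finset.sum_congr rfl fun j _ => ?_
  rw [Finset.sum_comm]
  simp

theorem superOpAdj_apply (ρ : Mat n) (j j' : Fin m) :
    G.superOpAdj ρ j j' = ∑ i, ∑ k, G.payoffObservable (i, j) (k, j') * ρ k i := by
  rw [superOpAdj, G.payoffObservable_isHermitian.eq]
  simp only [partialTraceA, Matrix.of_apply, Matrix.mul_apply,
    Matrix.kroneckerMap_apply, Fintype.sum_prod_type, Matrix.one_apply,
    mul_ite, mul_zero, mul_one]
  simp

theorem superOp_isHermitian {σ : Mat m} (hσ : σ.IsHermitian) : (G.superOp σ).IsHermitian := by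
  refine Matrix.IsHermitian.ext fun i i' => ?_
  rw [superOp_apply, superOp_apply, star_sum, Finset.sum_comm]
  simp only [star_sum, star_mul', G.payoffObservable_isHermitian.apply, hσ.apply]

theorem superOpAdj_isHermitian {ρ : Mat n} (hρ : ρ.IsHermitian) :
    (G.superOpAdj ρ).IsHermitian := by
  refine Matrix.IsHermitian.ext fun j j' => ?_
  rw [superOpAdj_apply, superOpAdj_apply, star_sum, Finset.sum_comm]
  simp only [star_sum, star_mul', G.payoffObservable_isHermitian.apply, hρ.apply]

theorem payoff_eq_trace_superOp {ρ : Mat n} (hρ : ρ.IsHermitian) (σ : Mat m) :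
    G.payoff ρ σ = (ρ * G.superOp σ).trace.re := by
  rw [G.payoff_eq ρ σ hρ, hsInner, hρ.eq]

theorem payoff_eq_trace_superOpAdj {ρ : Mat n} (hρ : ρ.IsHermitian) (σ : Mat m) :
    G.payoff ρ σ = (σ * G.superOpAdj ρ).trace.re := by
  rw [G.payoff_eq ρ σ hρ, hsInner_superOp, hsInner, (G.superOpAdj_isHermitian hρ).eq,
    Matrix.trace_mul_comm]

section Field

open scoped Matrix.Norms.Frobenius

/-- The super-operator `Φ` as a real-linear map. -/
def superOpₗ : Mat m →ₗ[ℝ] Mat n where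
  toFun := G.superOp
  map_add' σ σ' := by
    ext i i'
    simp only [Matrix.add_apply, superOp_apply, mul_add, Finset.sum_add_distrib]
  map_smul' c σ := by
    ext i i'
    simp only [Matrix.smul_apply, superOp_apply, Finset.smul_sum, mul_smul_comm,
      RingHom.id_apply]

/-- The adjoint super-operator `Φ†` as a real-linear map. -/
def superOpAdjₗ : Mat n →ₗ[ℝ] Mat m where
  toFun := G.superOpAdj
  map_add' ρ ρ' := by
    ext j j'
    simp only [Matrix.add_apply, superOpAdj_apply, mul_add, Finset.sum_add_distrib]
  map_smul' c ρ := by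
    ext j j'
    simp only [Matrix.smul_apply, superOpAdj_apply, Finset.smul_sum, mul_smul_comm,
      RingHom.id_apply]

/-- The velocity of Alice's traceless log-state, as a function of Bob's. -/
def fieldA (b : LogCoord m) : LogCoord n := tracelessPart n (G.superOp (gibbs b.mat))

/-- The velocity of Bob's traceless log-state, as a function of Alice's. -/
def fieldB (a : LogCoord n) : LogCoord m := -tracelessPart m (G.superOpAdj (gibbs a.mat))

theorem contDiff_fieldA [NeZero m] : ContDiff ℝ 1 G.fieldA :=
  (contDiff_linearMap (tracelessPart n ∘ₗ G.superOpₗ)).comp contDiff_gibbs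

theorem contDiff_fieldB [NeZero n] : ContDiff ℝ 1 G.fieldB :=
  ((contDiff_linearMap (tracelessPart m ∘ₗ G.superOpAdjₗ)).comp contDiff_gibbs).neg

/-- The fields are fixed linear maps applied to Gibbs states, up to sign, and density matrices have
norm at most one. -/
theorem exists_field_bound [NeZero n] [NeZero m] :
    ∃ M : ℝ, (∀ b, ‖G.fieldA b‖ ≤ M) ∧ ∀ a, ‖G.fieldB a‖ ≤ M := by
  obtain ⟨C, hC⟩ := exists_norm_linearMap_le (tracelessPart n ∘ₗ G.superOpₗ)
  obtain ⟨D, hD⟩ := exists_norm_linearMap_le (tracelessPart m ∘ₗ G.superOpAdjₗ)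
  refine ⟨max C D, fun b => (hC (gibbs b.mat) ?_).trans (le_max_left _ _), fun a => ?_⟩
  · exact norm_le_one_of_isDensityMatrix (gibbs_isDensityMatrix b.isHermitian)
  · rw [fieldB, norm_neg]
    refine (hD (gibbs a.mat) ?_).trans (le_max_right _ _)
    exact norm_le_one_of_isDensityMatrix (gibbs_isDensityMatrix a.isHermitian)

/-- The replicator vector field in traceless log-coordinates. -/
def field : LogCoord n × LogCoord m → LogCoord n × LogCoord m :=
  crossField G.fieldA G.fieldB

theorem exists_lipschitzOnWith_field [NeZero n] [NeZero m] (R : ℝ) :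
    ∃ K : NNReal, LipschitzOnWith K G.field (Metric.closedBall 0 R) :=
  exists_lipschitzOnWith_closedBall (contDiff_crossField G.contDiff_fieldA G.contDiff_fieldB) R

theorem exists_norm_field_le [NeZero n] [NeZero m] : ∃ M : ℝ, ∀ p, ‖G.field p‖ ≤ M :=
  let ⟨M, hA, hB⟩ := G.exists_field_bound
  ⟨M, norm_crossField_le hA hB⟩

/-- The divergence of the Nash equilibrium `(ρ, σ)` from the states with log-coordinates `p`, up to
a constant. -/
def lyapunov (ρ : Mat n) (σ : Mat m) (p : LogCoord n × LogCoord m) : ℝ :=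
  (Real.log (partitionFn p.1.mat) - (ρ * p.1.mat).trace.re) +
    (Real.log (partitionFn p.2.mat) - (σ * p.2.mat).trace.re)

end Field

end ZeroSumGame

/-! ### The conserved quantity, the correspondence with replicator orbits, and transfer of null
sets. -/

section Dynamics

open scoped Matrix.Norms.Frobenius

variable {n m : ℕ} {G : ZeroSumGame n m}

/-- The identity component removed from `X` contributes equally to both traces, as both states have
trace one, so the full `X` may appear in the derivative. -/
theorem hasDerivAt_log_partitionFn_sub [NeZero n] {ρ : Mat n} (hρ : IsDensityMatrix ρ)
    {a : ℝ → LogCoord n} {X : Mat n} (hX : X.IsHermitian) {t : ℝ}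
    (ha : HasDerivAt a (tracelessPart n X) t) :
    HasDerivAt (fun s => Real.log (partitionFn (a s).mat) - (ρ * (a s).mat).trace.re)
      ((gibbs (a t).mat * X).trace.re - (ρ * X).trace.re) t := by
  have hc : HasDerivAt (fun s => (a s).mat) (tracelessPart n X).mat t :=
    hasDerivAt_linearMap_comp LogCoord.mat ha
  have h1 := hasDerivAt_log_partitionFn (a t).isHermitian hc
  have h2 : HasDerivAt (fun s => (ρ * (a s).mat).trace.re)
      (ρ * (tracelessPart n X).mat).trace.re t :=
    hasDerivAt_linearMap_comp (reTrace n ∘ₗ LinearMap.mulLeft ℝ ρ) hc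
  have key : ∀ τ : Mat n, IsDensityMatrix τ → (τ * (tracelessPart n X).mat).trace.re =
      (τ * X).trace.re - X.trace.re / n := by
    intro τ hτ
    rw [mat_tracelessPart hX, Matrix.mul_sub, Matrix.mul_smul, Matrix.mul_one, Matrix.trace_sub,
      Matrix.trace_smul, hτ.2, smul_eq_mul, mul_one, Complex.sub_re, Complex.ofReal_re]
  refine (h1.sub h2).congr_deriv ?_
  rw [key _ (gibbs_isDensityMatrix (a t).isHermitian), key _ hρ]
  ring

theorem contDiff_log_partitionFn_sub [NeZero n] (ρ : Mat n) :
    ContDiff ℝ 1 (fun a : LogCoord n =>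
      Real.log (partitionFn a.mat) - (ρ * a.mat).trace.re) := by
  have hc : ContDiff ℝ 1 (fun a : LogCoord n => a.mat) :=
    contDiff_linearMap LogCoord.mat
  have h1 : ContDiff ℝ 1 (fun a : LogCoord n => partitionFn a.mat) :=
    contDiff_partitionFn.comp hc
  have h2 : ContDiff ℝ 1 (fun a : LogCoord n => (ρ * a.mat).trace.re) :=
    (contDiff_linearMap (reTrace n ∘ₗ LinearMap.mulLeft ℝ ρ)).comp hc
  exact (h1.log fun a => (partitionFn_pos a.isHermitian).ne').sub h2

theorem continuous_lyapunov [NeZero n] [NeZero m] (ρ : Mat n) (σ : Mat m) :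
    Continuous (ZeroSumGame.lyapunov ρ σ) :=
  ((contDiff_log_partitionFn_sub ρ).continuous.comp continuous_fst).add
    ((contDiff_log_partitionFn_sub σ).continuous.comp continuous_snd)

/-- At states `(ρ, σ)` the derivative is `(u(ρ, σ) - u(ρs, σ)) + (u(ρ, σs) - u(ρ, σ))`. The zero-sum
terms cancel, and the two left are both `u(ρs, σs)` by full rank. -/
theorem lyapunov_conserved [NeZero n] [NeZero m] {ρs : Mat n} {σs : Mat m}
    (h : G.IsNash ρs σs) (hρ : ρs.rank = n) (hσ : σs.rank = m)
    {z : ℝ → LogCoord n × LogCoord m} (hz : IsSolution G.field z) (t : ℝ) :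
    ZeroSumGame.lyapunov ρs σs (z t) = ZeroSumGame.lyapunov ρs σs (z 0) := by
  have hd : ∀ t, HasDerivAt (fun s => ZeroSumGame.lyapunov ρs σs (z s)) 0 t := by
    intro t
    have hga := gibbs_isDensityMatrix (z t).1.isHermitian
    have hgb := gibbs_isDensityMatrix (z t).2.isHermitian
    have h1 := hasDerivAt_log_partitionFn_sub h.1
      (G.superOp_isHermitian hgb.1.1) (hz t).fst
    have h2 := hasDerivAt_log_partitionFn_sub h.2.1 (G.superOpAdj_isHermitian hga.1.1).neg
      (a := fun s => (z s).2) (t := t) (by rw [map_neg]; exact (hz t).snd)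
    refine (h1.add h2).congr_deriv ?_
    rw [Matrix.mul_neg, Matrix.mul_neg, Matrix.trace_neg, Matrix.trace_neg, Complex.neg_re,
      Complex.neg_re, ← G.payoff_eq_trace_superOp hga.1.1, ← G.payoff_eq_trace_superOp h.1.1.1,
      ← G.payoff_eq_trace_superOpAdj hga.1.1, ← G.payoff_eq_trace_superOpAdj hga.1.1,
      h.payoff_left_eq hρ hga, h.payoff_right_eq hσ hgb]
    ring
  exact is_const_of_deriv_eq_zero (fun t => (hd t).differentiableAt) (fun t => (hd t).deriv) t 0

theorem norm_le_of_log_partitionFn_sub_le [NeZero n] {ρ : Mat n} (ht : ρ.trace = 1) {ε c : ℝ}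
    (hε : 0 < ε) (hρε : (ρ - (ε : ℂ) • (1 : Mat n)).PosSemidef) (a : LogCoord n)
    (hc : Real.log (partitionFn a.mat) - (ρ * a.mat).trace.re ≤ c) :
    ‖a‖ ≤ Real.sqrt (n * (c / ε) ^ 2) := by
  obtain ⟨h0, h1⟩ := log_partitionFn_sub_bounds ht hε hρε a.isHermitian a.trace_eq_zero
  refine Real.le_sqrt_of_sq_le ?_
  have h2 : ‖a‖ ^ 2 = (a.mat * a.mat).trace.re := by
    rw [← LogCoord.norm_mat, frobenius_norm_sq, a.isHermitian.eq]
  rw [h2]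
  refine h1.trans ?_
  gcongr

/-- Both summands are nonnegative, so a bound on the sum bounds each, and each is coercive. -/
theorem isBounded_lyapunov_le [NeZero n] [NeZero m] {ρs : Mat n} {σs : Mat m}
    (hρs : IsDensityMatrix ρs) (hσs : IsDensityMatrix σs) (hρ : ρs.rank = n) (hσ : σs.rank = m)
    (c : ℝ) : Bornology.IsBounded {p | ZeroSumGame.lyapunov ρs σs p ≤ c} := by
  obtain ⟨ε, hε, hρε⟩ := exists_pos_smul_one_le hρs.1 hρ
  obtain ⟨δ, hδ, hσδ⟩ := exists_pos_smul_one_le hσs.1 hσ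
  refine isBounded_iff_forall_norm_le.2
    ⟨max (Real.sqrt (n * (c / ε) ^ 2)) (Real.sqrt (m * (c / δ) ^ 2)), fun p hp => ?_⟩
  have hp' : ZeroSumGame.lyapunov ρs σs p ≤ c := hp
  rw [ZeroSumGame.lyapunov] at hp'
  have h1 := (log_partitionFn_sub_bounds hρs.2 hε hρε p.1.isHermitian p.1.trace_eq_zero).1
  have h2 := (log_partitionFn_sub_bounds hσs.2 hδ hσδ p.2.isHermitian p.2.trace_eq_zero).1
  exact max_le_max (norm_le_of_log_partitionFn_sub_le hρs.2 hε hρε p.1 (by linarith))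
    (norm_le_of_log_partitionFn_sub_le hσs.2 hδ hσδ p.2 (by linarith))

/-- The pair of states with traceless log-coordinates `p`. -/
def gibbsPair (p : LogCoord n × LogCoord m) : Mat n × Mat m :=
  (gibbs p.1.mat, gibbs p.2.mat)

theorem contDiff_gibbsPair [NeZero n] [NeZero m] :
    ContDiff ℝ 1 (gibbsPair : LogCoord n × LogCoord m → Mat n × Mat m) :=
  (contDiff_gibbs.comp contDiff_fst).prodMk (contDiff_gibbs.comp contDiff_snd)

theorem gibbsPair_injective [NeZero n] [NeZero m] :
    Function.Injective
      (gibbsPair : LogCoord n × LogCoord m → Mat n × Mat m) := by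
  intro p q h
  have h1 := eq_of_gibbs_eq p.1.isHermitian q.1.isHermitian p.1.trace_eq_zero q.1.trace_eq_zero (congrArg Prod.fst h)
  have h2 := eq_of_gibbs_eq p.2.isHermitian q.2.isHermitian p.2.trace_eq_zero q.2.trace_eq_zero (congrArg Prod.snd h)
  exact Prod.ext (LogCoord.mat_injective h1) (LogCoord.mat_injective h2)

theorem exists_tracelessHermitian_gibbs_eq {ρ : Mat n} (hρ : IsFullRankState ρ) :
    ∃ a : LogCoord n, gibbs a.mat = ρ := by
  obtain ⟨A, hA, h⟩ := exists_gibbs_eq hρ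
  exact ⟨tracelessPart n A, by rw [gibbs_tracelessPart hA, h]⟩

theorem IsReplicatorOrbit.exists_isSolution [NeZero n] [NeZero m] {x : ℝ → Mat n × Mat m}
    (hx : IsReplicatorOrbit G x) : ∃ z, IsSolution G.field z ∧ ∀ t, x t = gibbsPair (z t) := by
  obtain ⟨A, B, h⟩ := hx
  have hxz : ∀ t, x t = gibbsPair (tracelessPart n (A t), tracelessPart m (B t)) := fun t => by
    rw [(h t).2.2.1, gibbsPair, gibbs_tracelessPart (h t).1, gibbs_tracelessPart (h t).2.1]
  refine ⟨fun t => (tracelessPart n (A t), tracelessPart m (B t)), fun t => ?_, hxz⟩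
  obtain ⟨_, _, _, hA, hB⟩ := h t
  rw [hxz t] at hA hB
  have h1 := hasDerivAt_linearMap_comp (tracelessPart n) hA
  have h2 := hasDerivAt_linearMap_comp (tracelessPart m) hB
  rw [map_neg] at h2
  exact h1.prodMk h2

/-- The lost trace is restored by integrating it in time and adding the result as a multiple of the
identity, which the Gibbs state ignores. -/
theorem exists_hasDerivAt_of_tracelessPart {a : ℝ → LogCoord n} {X : ℝ → Mat n}
    (hX : ∀ t, (X t).IsHermitian) (hXc : Continuous X)
    (ha : ∀ t, HasDerivAt a (tracelessPart n (X t)) t) :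
    ∃ A : ℝ → Mat n, ∀ t, (A t).IsHermitian ∧ gibbs (A t) = gibbs (a t).mat ∧
      HasDerivAt A (X t) t := by
  have hc : Continuous fun t => (X t).trace.re / n :=
    ((contDiff_linearMap (reTrace n)).continuous.comp hXc).div_const _
  refine ⟨fun t => (a t).mat + ((∫ s in (0 : ℝ)..t, (X s).trace.re / n : ℝ) : ℂ) • 1,
    fun t => ⟨?_, gibbs_add_smul_one _ _, ?_⟩⟩
  · refine (a t).isHermitian.add ?_
    rw [Matrix.IsHermitian, Matrix.conjTranspose_smul, Matrix.conjTranspose_one,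
      Complex.star_def, Complex.conj_ofReal]
  · have h1 : HasDerivAt (fun s => (a s).mat) (tracelessPart n (X t)).mat t :=
      hasDerivAt_linearMap_comp LogCoord.mat (ha t)
    have h2 := ((hc.integral_hasStrictDerivAt 0 t).hasDerivAt).smul_const (1 : Mat n)
    have h3 := h1.add h2
    rw [mat_tracelessPart (hX t), Complex.coe_smul, sub_add_cancel] at h3
    exact h3

theorem IsSolution.isReplicatorOrbit [NeZero n] [NeZero m]
    {z : ℝ → LogCoord n × LogCoord m} (hz : IsSolution G.field z) :
    IsReplicatorOrbit G (fun t => gibbsPair (z t)) := by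
  have hzc : Continuous z := continuous_iff_continuousAt.2 fun t => (hz t).continuousAt
  have hgc : Continuous fun t => gibbsPair (z t) := contDiff_gibbsPair.continuous.comp hzc
  obtain ⟨A, hA⟩ := exists_hasDerivAt_of_tracelessPart
    (X := fun t => G.superOp (gibbsPair (z t)).2)
    (fun t => G.superOp_isHermitian (gibbs_isDensityMatrix (z t).2.isHermitian).1.1)
    ((contDiff_linearMap G.superOpₗ).continuous.comp (continuous_snd.comp hgc)) (fun t => (hz t).fst)
  obtain ⟨B, hB⟩ := exists_hasDerivAt_of_tracelessPart
    (a := fun t => (z t).2) (X := fun t => -G.superOpAdj (gibbsPair (z t)).1)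
    (fun t => (G.superOpAdj_isHermitian (gibbs_isDensityMatrix (z t).1.isHermitian).1.1).neg)
    ((contDiff_linearMap G.superOpAdjₗ).continuous.comp (continuous_fst.comp hgc)).neg
    (fun t => by rw [map_neg]; exact (hz t).snd)
  exact ⟨A, B, fun t => ⟨(hA t).1, (hB t).1, by rw [(hA t).2.1, (hB t).2.1]; rfl,
    (hA t).2.2, (hB t).2.2⟩⟩

theorem existsUnique_replicatorOrbit [NeZero n] [NeZero m] (G : ZeroSumGame n m) {ρ₀ : Mat n}
    {σ₀ : Mat m} (hρ : IsFullRankState ρ₀) (hσ : IsFullRankState σ₀) :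
    ∃! x : ℝ → Mat n × Mat m, IsReplicatorOrbit G x ∧ x 0 = (ρ₀, σ₀) := by
  obtain ⟨M, hM⟩ := G.exists_norm_field_le
  obtain ⟨a, rfl⟩ := exists_tracelessHermitian_gibbs_eq hρ
  obtain ⟨b, rfl⟩ := exists_tracelessHermitian_gibbs_eq hσ
  obtain ⟨z, hz0, hz⟩ := exists_isSolution G.exists_lipschitzOnWith_field hM (a, b)
  have hx0 : gibbsPair (z 0) = (gibbs a.mat, gibbs b.mat) := by rw [hz0, gibbsPair]
  refine ⟨fun t => gibbsPair (z t), ⟨hz.isReplicatorOrbit, hx0⟩, ?_⟩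
  rintro y ⟨hy, hy0⟩
  obtain ⟨w, hw, hyw⟩ := hy.exists_isSolution
  have h0 : w 0 = z 0 := gibbsPair_injective (by rw [← hyw 0, hy0, hx0])
  have hwz := hw.unique G.exists_lipschitzOnWith_field hM hz h0
  funext t
  rw [hyw t, hwz]

/-- Null sets of log-coordinates correspond to null sets of states. -/
theorem forAlmostEveryState_of_ae_gibbsPair [NeZero n] [NeZero m]
    [MeasurableSpace (LogCoord n)] [BorelSpace (LogCoord n)]
    [MeasurableSpace (LogCoord m)] [BorelSpace (LogCoord m)]
    {μ : Measure (LogCoord n × LogCoord m)} [μ.IsAddHaarMeasure]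
    {P : Mat n × Mat m → Prop} (hP : ∀ᵐ p ∂μ, P (gibbsPair p))
    (hrange : ∀ q, q ∉ Set.range (gibbsPair (n := n) (m := m)) → P q) :
    ForAlmostEveryState n m P := by
  intro d b
  -- `gibbsPair` read in the affine chart `statePair`: a differentiable self-map of one
  -- finite-dimensional space, so images of null sets are null.
  set Γ : LogCoord n × LogCoord m → LogCoord n × LogCoord m :=
    fun p => (tracelessPart n (gibbsPair p).1, tracelessPart m (gibbsPair p).2) with hΓ
  have hΓd : Differentiable ℝ Γ :=
    (((contDiff_linearMap (tracelessPart n)).comp (contDiff_fst.comp contDiff_gibbsPair)).prodMk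
      ((contDiff_linearMap (tracelessPart m)).comp
        (contDiff_snd.comp contDiff_gibbsPair))).differentiable one_ne_zero
  have hnull : μ (Γ '' {p | ¬ P (gibbsPair p)}) = 0 :=
    addHaar_image_eq_zero_of_differentiableOn_of_addHaar_eq_zero μ hΓd.differentiableOn hP
  have key : ∀ {k : ℕ} (X : LogCoord k),
      tracelessPart k ((k : ℂ)⁻¹ • (1 : Mat k) + X.mat) = X := by
    intro k X
    have h := tracelessPart_smul_one (n := k) (k : ℝ)⁻¹
    rw [Complex.ofReal_inv, Complex.ofReal_natCast] at h
    rw [map_add, h, zero_add, tracelessPart_mat]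
  have hstate : ∀ (p : LogCoord n × LogCoord m) (q : tracelessHermitian n × tracelessHermitian m),
      statePair q = gibbsPair p → Γ p = q := by
    intro p q h
    change (tracelessPart n (gibbsPair p).1, tracelessPart m (gibbsPair p).2) = _
    rw [← h]
    exact Prod.ext (key (k := n) q.1) (key (k := m) q.2)
  let e : (Fin d → ℝ) ≃ₗ[ℝ] LogCoord n × LogCoord m := b.equivFun.symm
  have hec : Continuous e := LinearMap.continuous_of_finiteDimensional e.toLinearMap
  -- Every linear coordinate system induces a Haar measure, so the null sets do not depend on `b`.
  have : (Measure.map e (volume : Measure (Fin d → ℝ))).IsAddHaarMeasure :=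
    e.toAddEquiv.isAddHaarMeasure_map volume hec
      (LinearMap.continuous_of_finiteDimensional e.symm.toLinearMap)
  have hac : Measure.map e (volume : Measure (Fin d → ℝ)) ≪ μ :=
    Measure.absolutelyContinuous_isAddHaarMeasure _ _
  have hae : ∀ᵐ q ∂(Measure.map e (volume : Measure (Fin d → ℝ))),
      q ∉ Γ '' {p | ¬ P (gibbsPair p)} :=
    measure_eq_zero_iff_ae_notMem.1 (hac hnull)
  filter_upwards [ae_of_ae_map hec.aemeasurable hae] with c hc _ _
  by_cases hr : statePair (b.equivFun.symm c) ∈ Set.range (gibbsPair (n := n) (m := m))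
  · obtain ⟨p, hp⟩ := hr
    by_contra hPc
    rw [← hp] at hPc
    exact hc ⟨p, hPc, hstate p _ hp.symm⟩
  · exact hrange _ hr

theorem forAlmostEveryState_recurrent (hG : G.HasFullyMixedNash) :
    ForAlmostEveryState n m fun p =>
      ∀ x : ℝ → Mat n × Mat m, IsReplicatorOrbit G x → x 0 = p → IsRecurrentOrbit x := by
  obtain ⟨ρs, σs, hN, hρ, hσ⟩ := hG
  have := neZero_of_isDensityMatrix hN.1
  have := neZero_of_isDensityMatrix hN.2.1
  let _ : MeasurableSpace (LogCoord n) := borel _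
  have : BorelSpace (LogCoord n) := ⟨rfl⟩
  let _ : MeasurableSpace (LogCoord m) := borel _
  have : BorelSpace (LogCoord m) := ⟨rfl⟩
  obtain ⟨M, hA, hB⟩ := G.exists_field_bound
  have hrec := ae_recurrent_crossField (μ := Measure.addHaar) (ν := Measure.addHaar)
    G.contDiff_fieldA G.contDiff_fieldB hA hB (continuous_lyapunov ρs σs).measurable
    (fun z hz t => lyapunov_conserved hN hρ hσ hz t)
    (isBounded_lyapunov_le hN.1 hN.2.1 hρ hσ)
  refine forAlmostEveryState_of_ae_gibbsPair
    (μ := (Measure.addHaar : Measure (LogCoord n)).prod Measure.addHaar) ?_ ?_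
  · filter_upwards [hrec] with p hp x hx hx0
    obtain ⟨z, hz, hxz⟩ := hx.exists_isSolution
    have hz0 : z 0 = p := gibbsPair_injective (by rw [← hxz 0, hx0])
    obtain ⟨τ, hτ, hlim⟩ := hp z hz hz0
    refine ⟨τ, hτ, ?_⟩
    simp only [hxz]
    exact (contDiff_gibbsPair.continuous.tendsto _).comp hlim
  -- Every orbit takes values in the range of `gibbsPair`, so none starts at such a `q`.
  · intro q hq x hx hx0
    obtain ⟨z, _, hxz⟩ := hx.exists_isSolution
    exact absurd ⟨z 0, by rw [← hxz 0, hx0]⟩ hq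

end Dynamics

end QuantumGame

end

theorem theorem4p3 (n m : ℕ) (G : QuantumGame.ZeroSumGame n m) (hG : G.HasFullyMixedNash) :
    (∀ (ρ₀ : QuantumGame.Mat n) (σ₀ : QuantumGame.Mat m),
      QuantumGame.IsFullRankState ρ₀ → QuantumGame.IsFullRankState σ₀ →
      ∃! x : ℝ → QuantumGame.Mat n × QuantumGame.Mat m,
        QuantumGame.IsReplicatorOrbit G x ∧ x 0 = (ρ₀, σ₀)) ∧
    QuantumGame.ForAlmostEveryState n m (fun p =>
      ∀ x : ℝ → QuantumGame.Mat n × QuantumGame.Mat m,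
        QuantumGame.IsReplicatorOrbit G x → x 0 = p → QuantumGame.IsRecurrentOrbit x) := by
  obtain ⟨ρs, σs, hN, -, -⟩ := id hG
  have := QuantumGame.neZero_of_isDensityMatrix hN.1
  have := QuantumGame.neZero_of_isDensityMatrix hN.2.1
  exact ⟨fun _ _ hρ hσ => QuantumGame.existsUnique_replicatorOrbit G hρ hσ,
    QuantumGame.forAlmostEveryState_recurrent hG⟩
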